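/- Let $X$ be a compact connected translation surface with underlying space $S$ and a non-empty finite set $\Sigma$ of cone points and marked points. An affine automorphism of $X$ is a homeomorphism of $S$ that preserves $\Sigma$ and is, in translation charts, locally of the form $z\mapsto Az+c$ with linear part $A\in SL(2,\mathbb R)$ not depending on the chart; the linear parts of all affine automorphisms form the Veech group of $X$ (the same definitions apply to non-compact translation surfaces). Let $G$ be a torsion-free subgroup of finite index of the group of affine automorphisms of $X$ (the full group, if it is torsion-free), and let $\Gamma\subset SL(2,\mathbb R)$ be the group of linear parts of its elements. $G$ acts on $H^1(S,\mathbb R)$, and for a $G$-invariant subspace $V$ we write $\rho_V$ for the action of $G$ on $V$. A subspace is integer if it is spanned by classes coming from $H^1(S,\mathbb Z)$. A discrete subgroup of $SL(2,\mathbb R)$ is of the first kind if its limit set in $\mathbb R\cup\{\infty\}$ is everything, and of the second kind if it is non-elementary (infinite limit set) and its limit set is not everything. Let $F^{(1)},\dots,F^{(n)}\subset H^1(S,\mathbb R)$ be integer $G$-invariant subspaces in direct sum, $F=\bigoplus_j F^{(j)}$ (for example, subspaces of the space $\ker\mathrm{hol}$ of zero-drift classes), and let $K_j=\ker\rho_{F^{(j)}}$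 and $K=\ker\rho_F$. Let $\mathbf f=(f_1,\dots,f_d)$ be linearly independent classes in $H^1(S,\mathbb Z)$ whose images in $H^1(S,\mathbb R)$ lie in $F$, and let $X_{\mathbf f}$ be the $\mathbb Z^d$-cover of $X$ that they define, i.e. the connected covering corresponding to $\bigcap_i\ker(f_i:\pi_1(S)\to\mathbb Z)$, with the pulled-back translation structure, whose singular and marked points are the preimages of those of $X$. Suppose that every $K_j$ is non-trivial. Then $K=\bigcap_j K_j$. Moreover, if $\Gamma$ is of the first kind (resp. of the second kind), then (the group of linear parts of) $K$ is of the first kind (resp. of the second kind), and so is the Veech group of $X_{\mathbf f}$. -/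

import Mathlib

open Set Topology Filter
open scoped MatrixGroups UpperHalfPlane unitInterval

noncomputable section

/-! ### First singular cohomology, through the explicit singular cochain complex -/

/-- The affine edge from the `i`-th to the `j`-th vertex of the standard `2`-simplex. -/
def simplexEdge (i j : Fin 3) : C(I, stdSimplex ℝ (Fin 3)) where
  toFun t := ⟨(1 - (t : ℝ)) • Pi.single i (1 : ℝ) + (t : ℝ) • Pi.single j (1 : ℝ),
    convex_stdSimplex ℝ (Fin 3) (single_mem_stdSimplex ℝ i) (single_mem_stdSimplex ℝ j)
      (by linarith [t.2.2]) t.2.1 (by ring)⟩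
  continuous_toFun := by fun_prop

/-- Singular `1`-cocycles of `S` with coefficients in `R`: functions on singular `1`-simplices
(paths) that vanish on the boundary of every singular `2`-simplex. -/
def singularCocycles (R : Type*) [CommRing R] (S : Type*) [TopologicalSpace S] :
    Submodule R (C(I, S) → R) where
  carrier := {c | ∀ s : C(stdSimplex ℝ (Fin 3), S),
    c (s.comp (simplexEdge 1 2)) - c (s.comp (simplexEdge 0 2))
      + c (s.comp (simplexEdge 0 1)) = 0}
  zero_mem' := by intro s; simp
  add_mem' := by
    intro a b ha hb s
    have h1 := ha s
    have h2 := hb s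
    simp only [Pi.add_apply]
    linear_combination h1 + h2
  smul_mem' := by
    intro r a ha s
    have h1 := ha s
    simp only [Pi.smul_apply, smul_eq_mul]
    linear_combination r * h1

/-- The singular coboundary of a `0`-cochain. -/
def singularCoboundary (R : Type*) [CommRing R] (S : Type*) [TopologicalSpace S] :
    (S → R) →ₗ[R] (C(I, S) → R) where
  toFun b γ := b (γ 1) - b (γ 0)
  map_add' a b := by ext γ; simp only [Pi.add_apply]; ring
  map_smul' r a := by ext γ; simp only [Pi.smul_apply, smul_eq_mul, RingHom.id_apply]; ring

/-- The first singular cohomology `H¹(S, R)`: singular `1`-cocycles modulo coboundaries. -/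
abbrev SingularH1 (R : Type*) [CommRing R] (S : Type*) [TopologicalSpace S] : Type _ :=
  singularCocycles R S ⧸
    (LinearMap.range (singularCoboundary R S)).comap (singularCocycles R S).subtype

namespace SingularH1

variable {R : Type*} [CommRing R] {S T U : Type*}
  [TopologicalSpace S] [TopologicalSpace T] [TopologicalSpace U]

/-- The value of a cohomology class on (the homology class of) a loop. -/
def period (R : Type*) [CommRing R] (γ : C(I, S)) (hγ : γ 0 = γ 1) : SingularH1 R S →ₗ[R] R :=
  Submodule.liftQ _ ((LinearMap.proj γ).comp (singularCocycles R S).subtype) (by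
    rintro ⟨c, hc⟩ ⟨b, hb⟩
    have : c = singularCoboundary R S b := hb.symm
    subst this
    simp [singularCoboundary, hγ])

/-- Pullback of singular cocycles by a continuous map. -/
def cocycleMap (h : C(S, T)) : singularCocycles R T →ₗ[R] singularCocycles R S where
  toFun c := ⟨fun γ => c.1 (h.comp γ), fun s => c.2 (h.comp s)⟩
  map_add' _ _ := rfl
  map_smul' _ _ := rfl

/-- Pullback in cohomology by a continuous map. -/
def map (h : C(S, T)) : SingularH1 R T →ₗ[R] SingularH1 R S :=
  Submodule.mapQ _ _ (cocycleMap h) (by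
    rintro ⟨c, hc⟩ ⟨b, hb⟩
    have : c = singularCoboundary R T b := hb.symm
    subst this
    exact ⟨b ∘ h, rfl⟩)

theorem map_id : map (R := R) (ContinuousMap.id S) = LinearMap.id := by
  refine LinearMap.ext fun x => ?_
  obtain ⟨c, rfl⟩ := Submodule.Quotient.mk_surjective _ x
  rfl

theorem map_comp (h : C(T, U)) (k : C(S, T)) :
    map (R := R) (h.comp k) = (map k).comp (map h) := by
  refine LinearMap.ext fun x => ?_
  obtain ⟨c, rfl⟩ := Submodule.Quotient.mk_surjective _ x
  rfl

/-- Extension of coefficients on cocycles, from `ℤ` to `ℝ`. -/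
def cocycleToReal : singularCocycles ℤ S →ₗ[ℤ] singularCocycles ℝ S where
  toFun c := ⟨fun γ => (c.1 γ : ℝ), fun s => by
    have h := congrArg (Int.cast : ℤ → ℝ) (c.2 s)
    push_cast at h
    exact h⟩
  map_add' a b := by ext γ; simp
  map_smul' n a := by ext γ; simp

/-- Extension of coefficients `H¹(S, ℤ) → H¹(S, ℝ)`. -/
def toReal : SingularH1 ℤ S →ₗ[ℤ] SingularH1 ℝ S :=
  Submodule.liftQ _ ((Submodule.mkQ ((LinearMap.range (singularCoboundary ℝ S)).comap
      (singularCocycles ℝ S).subtype)).restrictScalars ℤ ∘ₗ cocycleToReal) (by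
    rintro ⟨c, hc⟩ ⟨b, hb⟩
    have : c = singularCoboundary ℤ S b := hb.symm
    subst this
    refine (Submodule.Quotient.mk_eq_zero _).2 ⟨fun s => (b s : ℝ), ?_⟩
    ext γ
    simp [singularCoboundary, cocycleToReal])

/-- A real subspace of `H¹(S, ℝ)` is integer (defined over `ℤ`) if it is spanned by
integer classes. -/
def IsInteger (F : Submodule ℝ (SingularH1 ℝ S)) : Prop :=
  Submodule.span ℝ ((F : Set (SingularH1 ℝ S)) ∩ Set.range (toReal (S := S))) = F

end SingularH1

/-! ### Translation surfaces, affine automorphisms, Veech groups -/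

/-- The linear action of `SL(2, ℝ)` on the plane `ℝ² = ℂ`. -/
def planeAct (A : SL(2, ℝ)) (z : ℂ) : ℂ :=
  ⟨A.1 0 0 * z.re + A.1 0 1 * z.im, A.1 1 0 * z.re + A.1 1 1 * z.im⟩

theorem planeAct_one (z : ℂ) : planeAct 1 z = z := by
  apply Complex.ext <;> simp [planeAct]

theorem planeAct_add (A : SL(2, ℝ)) (z w : ℂ) :
    planeAct A (z + w) = planeAct A z + planeAct A w := by
  apply Complex.ext <;> simp [planeAct] <;> ring

theorem planeAct_mul (A B : SL(2, ℝ)) (z : ℂ) :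
    planeAct (A * B) z = planeAct A (planeAct B z) := by
  apply Complex.ext <;> simp [planeAct, Matrix.mul_apply, Fin.sum_univ_two] <;> ring

/-- A translation structure on the space `S` with singular set `sing` (cone points and, possibly,
marked points): an atlas on the complement of `sing` whose transition maps are locally
translations, such that near each point of `sing` there is a coordinate `w`, centred at that
point, in which the translation charts are `w ^ k + const` for some `k ≥ 1`, that is, the
point has cone angle `2πk` (a marked regular point if `k = 1`). -/
structure TranslationSurface (S : Type*) [TopologicalSpace S] where
  /-- singularities and marked points -/
  sing : Set S
  /-- translation charts -/
  charts : Set (OpenPartialHomeomorph S ℂ)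
  disjoint_sing : ∀ φ ∈ charts, Disjoint φ.source sing
  exists_chart : ∀ x, x ∉ sing → ∃ φ ∈ charts, x ∈ φ.source
  translation : ∀ φ ∈ charts, ∀ ψ ∈ charts, ∀ x, x ∈ φ.source → x ∈ ψ.source →
    ∃ c : ℂ, ∀ᶠ y in 𝓝 x, ψ y = φ y + c
  cone : ∀ x ∈ sing, ∃ k : ℕ, 0 < k ∧ ∃ w : OpenPartialHomeomorph S ℂ,
    x ∈ w.source ∧ w x = 0 ∧ w.source ∩ sing = {x} ∧
    ∀ φ ∈ charts, ∀ y, y ∈ w.source → y ∈ φ.source →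
      ∃ c : ℂ, ∀ᶠ z in 𝓝 y, φ z = (w z) ^ k + c

namespace TranslationSurface

variable {S : Type*} [TopologicalSpace S] (X : TranslationSurface S)

/-- `h` is an (orientation- and area-preserving) affine automorphism of `X` with linear part `A`:
a homeomorphism preserving the singular set that is, in translation charts, locally of the form
`z ↦ A z + c`. -/
def IsAffine (h : S ≃ₜ S) (A : SL(2, ℝ)) : Prop :=
  (∀ x, h x ∈ X.sing ↔ x ∈ X.sing) ∧
  ∀ φ ∈ X.charts, ∀ ψ ∈ X.charts, ∀ x, x ∈ φ.source → h x ∈ ψ.source →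
    ∃ c : ℂ, ∀ᶠ y in 𝓝 x, ψ (h y) = planeAct A (φ y) + c

variable {X}

theorem IsAffine.one : X.IsAffine 1 1 := by
  refine ⟨fun x => Iff.rfl, fun φ hφ ψ hψ x hx hx' => ?_⟩
  obtain ⟨c, hc⟩ := X.translation φ hφ ψ hψ x hx hx'
  exact ⟨c, by simpa [planeAct_one] using hc⟩

theorem IsAffine.mul {g h : S ≃ₜ S} {A B : SL(2, ℝ)} (hg : X.IsAffine g A)
    (hh : X.IsAffine h B) : X.IsAffine (g * h) (A * B) := by
  refine ⟨fun x => (hg.1 (h x)).trans (hh.1 x), fun φ hφ ψ hψ x hx hx' => ?_⟩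
  have hxs : x ∉ X.sing := fun hs => (X.disjoint_sing φ hφ).le_bot ⟨hx, hs⟩
  obtain ⟨χ, hχ, hxχ⟩ := X.exists_chart (h x) (fun hs => hxs ((hh.1 x).1 hs))
  obtain ⟨c, hc⟩ := hh.2 φ hφ χ hχ x hx hxχ
  obtain ⟨d, hd⟩ := hg.2 χ hχ ψ hψ (h x) hxχ hx'
  refine ⟨planeAct A c + d, ?_⟩
  filter_upwards [hc, h.continuous.continuousAt.eventually hd] with y hy hy'
  change ψ (g (h y)) = _
  rw [hy', hy, planeAct_add, planeAct_mul, add_assoc]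

theorem IsAffine.inv {h : S ≃ₜ S} {A : SL(2, ℝ)} (hh : X.IsAffine h A) :
    X.IsAffine h⁻¹ A⁻¹ := by
  have key : ∀ x, h (h⁻¹ x) = x := fun x => h.apply_symm_apply x
  refine ⟨fun x => by rw [← hh.1, key], fun φ hφ ψ hψ x hx hx' => ?_⟩
  obtain ⟨c, hc⟩ := hh.2 ψ hψ φ hφ (h⁻¹ x) hx' (by rwa [key])
  refine ⟨-planeAct A⁻¹ c, ?_⟩
  have hcont : Filter.Tendsto (fun y => h⁻¹ y) (𝓝 x) (𝓝 (h⁻¹ x)) :=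
    (h⁻¹).continuous.continuousAt
  filter_upwards [hcont.eventually hc] with y hy
  rw [key] at hy
  rw [hy, planeAct_add, ← planeAct_mul, inv_mul_cancel, planeAct_one, add_neg_cancel_right]

variable (X)

/-- The group of affine automorphisms of `X`, each recorded together with its linear part
(which it determines). -/
def affineGroup : Subgroup ((S ≃ₜ S) × SL(2, ℝ)) where
  carrier := {g | X.IsAffine g.1 g.2}
  one_mem' := IsAffine.one
  mul_mem' ha hb := IsAffine.mul ha hb
  inv_mem' ha := IsAffine.inv ha

/-- The linear part (derivative) of an affine automorphism. -/
def derivative : X.affineGroup →* SL(2, ℝ) :=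
  (MonoidHom.snd (S ≃ₜ S) SL(2, ℝ)).comp X.affineGroup.subtype

/-- The Veech group: all linear parts of affine automorphisms. -/
def veechGroup : Subgroup SL(2, ℝ) := X.derivative.range

/-- The action of the affine group on `H¹(S, ℝ)`: the automorphism `h` acts by `(h⁻¹)^*`. -/
def cohomologyRep : Representation ℝ X.affineGroup (SingularH1 ℝ S) where
  toFun g := SingularH1.map ⟨(g.1.1⁻¹ : S ≃ₜ S), (g.1.1⁻¹ : S ≃ₜ S).continuous⟩
  map_one' := SingularH1.map_id
  map_mul' g h := by
    rw [Module.End.mul_eq_comp, ← SingularH1.map_comp]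
    congr 1

/-- The translation surface obtained by pulling back the structure of `X` along a local
homeomorphism (in particular, along a covering map); the singular set is the preimage. -/
def pullback {E : Type*} [TopologicalSpace E] (p : E → S) (hp : IsLocalHomeomorph p) :
    TranslationSurface E where
  sing := p ⁻¹' X.sing
  charts := {e | Disjoint e.source (p ⁻¹' X.sing) ∧ ∀ φ ∈ X.charts, ∀ x, x ∈ e.source →
    p x ∈ φ.source → ∃ c : ℂ, ∀ᶠ y in 𝓝 x, φ (p y) = e y + c}
  disjoint_sing := fun e he => he.1
  exists_chart := by
    intro x hx
    obtain ⟨φ, hφ, hxφ⟩ := X.exists_chart (p x) hx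
    obtain ⟨q, hxq, rfl⟩ := hp x
    refine ⟨q.trans φ, ⟨?_, ?_⟩, by simp [hxq, hxφ]⟩
    · rw [Set.disjoint_left]
      intro y hy hy'
      rw [OpenPartialHomeomorph.trans_source] at hy
      exact (X.disjoint_sing φ hφ).le_bot ⟨hy.2, hy'⟩
    · intro ψ hψ y hy hyψ
      rw [OpenPartialHomeomorph.trans_source] at hy
      obtain ⟨c, hc⟩ := X.translation φ hφ ψ hψ (q y) hy.2 hyψ
      exact ⟨c, (q.continuousAt hy.1).eventually hc⟩
  translation := by
    intro e he e' he' x hx hx'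
    have hxs : p x ∉ X.sing := fun hs => he.1.le_bot ⟨hx, hs⟩
    obtain ⟨φ, hφ, hxφ⟩ := X.exists_chart (p x) hxs
    obtain ⟨c, hc⟩ := he.2 φ hφ x hx hxφ
    obtain ⟨c', hc'⟩ := he'.2 φ hφ x hx' hxφ
    refine ⟨c - c', ?_⟩
    filter_upwards [hc, hc'] with y hy hy'
    linear_combination hy - hy'
  cone := by
    intro x hx
    obtain ⟨k, hk, w, hxw, hw0, hws, hw⟩ := X.cone (p x) hx
    obtain ⟨q, hxq, rfl⟩ := hp x
    refine ⟨k, hk, q.trans w, by simp [hxq, hxw], by simpa using hw0, ?_, ?_⟩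
    · ext y
      rw [OpenPartialHomeomorph.trans_source]
      constructor
      · rintro ⟨⟨hyq, hyw⟩, hys⟩
        have : q y ∈ w.source ∩ X.sing := ⟨hyw, hys⟩
        rw [hws] at this
        exact q.injOn hyq hxq this
      · rintro rfl
        exact ⟨⟨hxq, hxw⟩, hx⟩
    · intro e he y hy hye
      rw [OpenPartialHomeomorph.trans_source] at hy
      have hys : q y ∉ X.sing := fun hs => he.1.le_bot ⟨hye, hs⟩
      obtain ⟨φ, hφ, hyφ⟩ := X.exists_chart (q y) hys
      obtain ⟨c, hc⟩ := he.2 φ hφ y hye hyφ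
      obtain ⟨c', hc'⟩ := hw φ hφ (q y) hy.2 hyφ
      refine ⟨c' - c, ?_⟩
      filter_upwards [hc, (q.continuousAt hy.1).eventually hc'] with z hz hz'
      change e z = (w (q z)) ^ k + (c' - c)
      linear_combination hz' - hz

variable {X}

/-- The linear part, on a subgroup `G` of the affine group. Its range is the group of linear
parts of the elements of `G`. -/
def linearPart (G : Subgroup X.affineGroup) : G →* SL(2, ℝ) := X.derivative.comp G.subtype

/-- The action on `H¹(S, ℝ)` of a subgroup `G` of the affine group. -/
def rep (G : Subgroup X.affineGroup) : Representation ℝ G (SingularH1 ℝ S) :=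
  X.cohomologyRep.comp G.subtype

/-- The sum of a family of invariant subspaces. -/
def sumSubrep {G : Subgroup X.affineGroup} {ι : Type*} (F : ι → Subrepresentation (rep G)) :
    Subrepresentation (rep G) where
  toSubmodule := ⨆ j, (F j).toSubmodule
  apply_mem_toSubmodule g v hv := by
    have : (⨆ j, (F j).toSubmodule) ≤ (⨆ j, (F j).toSubmodule).comap (rep G g) :=
      iSup_le fun j u hu =>
        Submodule.mem_iSup_of_mem j ((F j).apply_mem_toSubmodule g hu)
    exact this hv

/-- The kernel of the representation `ρ_F : G → GL(F)` on an invariant subspace `F`. -/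
def repKer {G : Subgroup X.affineGroup} (F : Subrepresentation (rep G)) : Subgroup G :=
  MonoidHom.ker F.toRepresentation

end TranslationSurface

/-- `p : E → S` is the connected abelian cover of `S` defined by the integer classes `f i`: a
connected covering such that a path in `E` joining two points of the same fibre is closed
if and only if all the `f i` vanish on the loop it projects to. In other words,
`p_* π₁(E) = ⋂ i, ker (f i : π₁(S) → ℤ)`. If `f` is a linearly independent `d`-tuple, the group of
deck transformations is isomorphic to `ℤ^d`. -/
structure IsCoverDefinedBy {S E : Type*} [TopologicalSpace S] [TopologicalSpace E] {ι : Type*}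
    (f : ι → SingularH1 ℤ S) (p : C(E, S)) : Prop where
  isCoveringMap : IsCoveringMap p
  connected : ConnectedSpace E
  closed_iff : ∀ (γ : C(I, E)) (hγ : p (γ 0) = p (γ 1)),
    γ 0 = γ 1 ↔ ∀ i, SingularH1.period ℤ (p.comp γ) hγ (f i) = 0

/-! ### Fuchsian groups -/

/-- The limit set of `Γ ≤ SL(2, ℝ)`: the points of the boundary circle `ℝ ∪ {∞}` of the
hyperbolic plane that are limits, in the Riemann sphere, of points of some orbit of `Γ` in the
upper half-plane. -/
def limitSet (Γ : Subgroup SL(2, ℝ)) : Set (OnePoint ℝ) :=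
  {ξ | ∃ z : ℍ, OnePoint.map (fun t : ℝ => (t : ℂ)) ξ ∈
    closure ((fun w : ℍ => (((w : ℂ)) : OnePoint ℂ)) '' MulAction.orbit Γ z)}

/-- `Γ` is a Fuchsian (discrete) group of the first kind: its limit set is the whole
boundary circle. -/
def IsFirstKind (Γ : Subgroup SL(2, ℝ)) : Prop :=
  DiscreteTopology Γ ∧ limitSet Γ = Set.univ

/-- `Γ` is a (non-elementary) Fuchsian group of the second kind: its limit set is infinite and is
not the whole boundary circle. -/
def IsSecondKind (Γ : Subgroup SL(2, ℝ)) : Prop :=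
  DiscreteTopology Γ ∧ (limitSet Γ).Infinite ∧ limitSet Γ ≠ Set.univ

end

/-!
The boundary points in the limit set of a group `H` can be read off the nonzero degenerate matrices
in the closure of the cone over `H`. Conjugating one non-trivial element of a normal subgroup `N`
of `Γ` by a sequence in `Γ` shows that `N` accumulates wherever `Γ` does, unless `N` is elementary.
In a torsion-free non-elementary discrete group two non-trivial normal subgroups meet
non-trivially, since otherwise they would commute and share their fixed points. Hence
`K = ⋂ j, K j` is non-trivial and has the limit set of `Γ`.

Elements of `K` fix the classes that define the cover, so they lift to it, and the Veech group of
the cover accumulates at least where `Γ` does. Conversely, the translations of the cover permute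
the singular points, which lie over a finite set, so the deck group has finite index in the group
of all translations. The deck group is finitely generated, hence so is the group of translations,
which then has only finitely many subgroups of that index. Therefore a subgroup of finite index of
the affine group of the cover normalizes the deck group and descends to `X`. This gives the reverse
inclusion of limit sets and discreteness.
-/

noncomputable section

/-! ### Proportionality in the plane -/

namespace Plane

open Matrix

section CommRing

variable {R : Type*} [CommRing R]

/-- The standard area form of the plane `R²`. Over a field it vanishes exactly on pairs of
proportional vectors, and it is used throughout as the test for proportionality. -/
def area (u v : Fin 2 → R) : R := u 0 * v 1 - u 1 * v 0

theorem area_self (u : Fin 2 → R) : area u u = 0 := by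
  simp only [area]; ring

theorem area_swap (u v : Fin 2 → R) : area u v = -area v u := by
  simp only [area]; ring

theorem area_add_right (u v w : Fin 2 → R) : area u (v + w) = area u v + area u w := by
  simp only [area, Pi.add_apply]; ring

theorem area_smul_right (c : R) (u v : Fin 2 → R) : area u (c • v) = c * area u v := by
  simp only [area, Pi.smul_apply, smul_eq_mul]; ring

theorem area_mulVec (M : Matrix (Fin 2) (Fin 2) R) (u v : Fin 2 → R) :
    area (M *ᵥ u) (M *ᵥ v) = M.det * area u v := by
  simp only [area, mulVec, dotProduct, Fin.sum_univ_two, det_fin_two]; ring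

theorem area_specialLinearGroup_mulVec (g : SL(2, R)) (u v : Fin 2 → R) :
    area (g.1 *ᵥ u) (g.1 *ᵥ v) = area u v := by
  rw [area_mulVec, g.2, one_mul]

theorem area_smul_add_area_smul_add_area_smul (u v w : Fin 2 → R) :
    area v w • u + area w u • v + area u v • w = 0 := by
  ext i
  fin_cases i <;>
    simp only [area, Fin.zero_eta, Fin.mk_one, Pi.add_apply, Pi.smul_apply, Pi.zero_apply,
      smul_eq_mul] <;> ring

theorem left_ne_zero_of_area_ne_zero {u v : Fin 2 → R} (h : area u v ≠ 0) : u ≠ 0 := by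
  rintro rfl
  exact h (by simp only [area, Pi.zero_apply, zero_mul, sub_self])

theorem mul_self_eq_trace_smul_sub_det_smul (M : Matrix (Fin 2) (Fin 2) R) :
    M * M = M.trace • M - M.det • (1 : Matrix (Fin 2) (Fin 2) R) := by
  nontriviality R
  have h := M.aeval_self_charpoly
  simp only [charpoly_fin_two, map_add, map_sub, map_mul, Polynomial.aeval_X,
    Polynomial.aeval_C, Algebra.algebraMap_eq_smul_one, smul_mul_assoc, one_mul, pow_two] at h
  rw [← sub_eq_zero, ← h]
  abel

variable [IsDomain R]

theorem area_eq_zero_trans {u v w : Fin 2 → R} (hu : u ≠ 0) (huv : area u v = 0)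
    (huw : area u w = 0) : area v w = 0 := by
  have h := area_smul_add_area_smul_add_area_smul u v w
  rw [area_swap w u, huw, huv, neg_zero, zero_smul, zero_smul, add_zero, add_zero] at h
  exact (smul_eq_zero.1 h).resolve_right hu

theorem matrix_ext_of_area_ne_zero {u v : Fin 2 → R} (h : area u v ≠ 0)
    {M N : Matrix (Fin 2) (Fin 2) R} (hu : M *ᵥ u = N *ᵥ u) (hv : M *ᵥ v = N *ᵥ v) : M = N := by
  refine Matrix.ext_of_mulVec_single fun i => ?_
  have hw := congrArg ((M - N) *ᵥ ·) (area_smul_add_area_smul_add_area_smul u v (Pi.single i 1))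
  simp only [mulVec_add, mulVec_smul, sub_mulVec, hu, hv, sub_self, smul_zero, zero_add,
    mulVec_zero] at hw
  exact sub_eq_zero.1 ((smul_eq_zero.1 hw).resolve_left h)

end CommRing

section Field

variable {K : Type*} [Field K]

theorem area_eq_zero_iff {u v : Fin 2 → K} (hu : u ≠ 0) :
    area u v = 0 ↔ ∃ c : K, v = c • u := by
  refine ⟨fun h => ?_, ?_⟩
  · obtain ⟨w, hw⟩ : ∃ w, area u w ≠ 0 := by
      by_contra! hall
      refine hu (funext fun i => ?_)
      fin_cases i
      · simpa [area] using hall ![0, 1]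
      · simpa [area] using hall ![1, 0]
    refine ⟨(area u w)⁻¹ * area v w, ?_⟩
    have h' := area_smul_add_area_smul_add_area_smul u v w
    rw [h, zero_smul, add_zero, area_swap w u, neg_smul, ← sub_eq_add_neg, sub_eq_zero] at h'
    rw [mul_smul, h', inv_smul_smul₀ hw]
  · rintro ⟨c, rfl⟩
    rw [area_smul_right, area_self, mul_zero]

theorem exists_mulVec_eq {u v : Fin 2 → K} (h : area u v ≠ 0) (x y : Fin 2 → K) :
    ∃ M : Matrix (Fin 2) (Fin 2) K, M *ᵥ u = x ∧ M *ᵥ v = y := by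
  have hleft (w) : ![v 1, -v 0] ⬝ᵥ w = area w v := by
    simp only [area, dotProduct, Fin.sum_univ_two, cons_val_zero, cons_val_one]; ring
  have hright (w) : ![-u 1, u 0] ⬝ᵥ w = area u w := by
    simp only [area, dotProduct, Fin.sum_univ_two, cons_val_zero, cons_val_one]; ring
  refine ⟨(area u v)⁻¹ • (vecMulVec x ![v 1, -v 0] + vecMulVec y ![-u 1, u 0]), ?_, ?_⟩ <;>
    simp only [smul_mulVec, add_mulVec, vecMulVec_mulVec, op_smul_eq_smul, hleft, hright,
      area_self, zero_smul, add_zero, zero_add, inv_smul_smul₀ h]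

theorem exists_mulVec_eq_smul_iff {M : Matrix (Fin 2) (Fin 2) K} {c : K} :
    (∃ u, u ≠ 0 ∧ M *ᵥ u = c • u) ↔ c ^ 2 - M.trace * c + M.det = 0 := by
  have hdet : (M - c • (1 : Matrix (Fin 2) (Fin 2) K)).det = c ^ 2 - M.trace * c + M.det := by
    simp only [det_fin_two, trace_fin_two, Matrix.sub_apply, Matrix.smul_apply, one_apply_eq,
      smul_eq_mul, one_apply_ne (zero_ne_one (α := Fin 2)), one_apply_ne (one_ne_zero (α := Fin 2))]
    ring
  rw [← hdet, ← exists_mulVec_eq_zero_iff]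
  simp only [sub_mulVec, smul_mulVec, one_mulVec, sub_eq_zero]

end Field

end Plane

/-! ### Limit sets and cones of matrices -/

namespace Fuchsian

open Matrix Plane

/-- The point of the Riemann sphere with homogeneous coordinates `[x 0 : x 1]`, where `∞ = [1 : 0]`;
the excluded vector `0` is sent to `∞`. -/
def toSphere (x : Fin 2 → ℂ) : OnePoint ℂ :=
  if x 1 = 0 then OnePoint.infty else ((x 0 / x 1 : ℂ) : OnePoint ℂ)

theorem ne_zero_of_apply_one_eq_zero {x : Fin 2 → ℂ} (hx : x ≠ 0) (h : x 1 = 0) : x 0 ≠ 0 :=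
  fun h0 => hx (funext fun i => by fin_cases i <;> assumption)

theorem toSphere_smul {c : ℂ} (hc : c ≠ 0) (x : Fin 2 → ℂ) : toSphere (c • x) = toSphere x := by
  simp only [toSphere, Pi.smul_apply, smul_eq_mul, mul_eq_zero, hc, false_or,
    mul_div_mul_left _ _ hc]

theorem toSphere_eq_toSphere_iff {x y : Fin 2 → ℂ} (hx : x ≠ 0) (hy : y ≠ 0) :
    toSphere x = toSphere y ↔ area x y = 0 := by
  by_cases hx1 : x 1 = 0 <;> by_cases hy1 : y 1 = 0
  · simp [toSphere, area, hx1, hy1]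
  · simp [toSphere, area, hx1, hy1, ne_zero_of_apply_one_eq_zero hx hx1]
  · simp [toSphere, area, hx1, hy1, ne_zero_of_apply_one_eq_zero hy hy1]
  · simp only [toSphere, area, hx1, hy1, if_false, OnePoint.coe_eq_coe, div_eq_div_iff hx1 hy1,
      sub_eq_zero, mul_comm]

theorem continuousAt_toSphere {x : Fin 2 → ℂ} (hx : x ≠ 0) : ContinuousAt toSphere x := by
  by_cases hx1 : x 1 = 0
  · have hlim : toSphere x = OnePoint.infty := if_pos hx1
    rw [ContinuousAt, hlim]
    refine OnePoint.le_nhds_infty.2 fun K _ hK => ?_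
    obtain ⟨r, hr⟩ := hK.isBounded.exists_norm_le
    have hlt : ∀ᶠ y in 𝓝 x, r * ‖y 1‖ < ‖y 0‖ := by
      refine Tendsto.eventually_lt (Continuous.tendsto (by fun_prop) x)
        (Continuous.tendsto (by fun_prop) x) ?_
      rw [hx1, norm_zero, mul_zero]
      exact norm_pos_iff.2 (ne_zero_of_apply_one_eq_zero hx hx1)
    refine mem_map.2 (hlt.mono fun y hy => ?_)
    by_cases hy1 : y 1 = 0
    · exact Or.inr (if_pos hy1)
    · refine Or.inl ⟨y 0 / y 1, fun hmem => ?_, (if_neg hy1).symm⟩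
      refine (hr _ hmem).not_gt ?_
      rwa [norm_div, lt_div_iff₀ (norm_pos_iff.2 hy1)]
  · have hev : ∀ᶠ y in 𝓝 x, ((y 0 / y 1 : ℂ) : OnePoint ℂ) = toSphere y := by
      filter_upwards [(continuous_apply 1).continuousAt.eventually_ne hx1] with y hy
      exact (if_neg hy).symm
    refine ContinuousAt.congr (OnePoint.continuous_coe.continuousAt.comp ?_) hev
    exact (continuous_apply 0).continuousAt.div (continuous_apply 1).continuousAt hx1

/-- Homogeneous coordinates of the image of `z : ℂ` under the Möbius transformation of a real
matrix. -/
def mobiusVec (M : Matrix (Fin 2) (Fin 2) ℝ) (z : ℂ) : Fin 2 → ℂ :=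
  fun i => (M i 0 : ℂ) * z + M i 1

theorem continuous_mobiusVec (z : ℂ) : Continuous fun M => mobiusVec M z :=
  continuous_pi fun i => by unfold mobiusVec; fun_prop

theorem mobiusVec_smul (c : ℝ) (M : Matrix (Fin 2) (Fin 2) ℝ) (z : ℂ) :
    mobiusVec (c • M) z = (c : ℂ) • mobiusVec M z := by
  ext i
  simp only [mobiusVec, Matrix.smul_apply, Pi.smul_apply, smul_eq_mul, Complex.ofReal_mul]
  ring

theorem ofReal_mul_add_ofReal_eq_zero_iff {a b : ℝ} (z : ℍ) :
    (a : ℂ) * z + b = 0 ↔ a = 0 ∧ b = 0 := by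
  refine ⟨fun h => ?_, fun h => by simp [h]⟩
  have ha : a = 0 := by simpa [z.im_ne_zero] using congrArg Complex.im h
  exact ⟨ha, by simpa [ha] using h⟩

theorem mobiusVec_ne_zero {M : Matrix (Fin 2) (Fin 2) ℝ} (hM : M ≠ 0) (z : ℍ) :
    mobiusVec M z ≠ 0 := fun h => hM <| by
  have hrow (i) := (ofReal_mul_add_ofReal_eq_zero_iff z).1 (congrFun h i)
  ext i j
  fin_cases j
  exacts [(hrow i).1, (hrow i).2]

theorem coe_smul_eq_toSphere (g : SL(2, ℝ)) (z : ℍ) :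
    (((g • z : ℍ) : ℂ) : OnePoint ℂ) = toSphere (mobiusVec g.1 z) := by
  have hden : mobiusVec g.1 z 1 ≠ 0 := fun h => by
    have hrow := (ofReal_mul_add_ofReal_eq_zero_iff z).1 h
    have hdet := g.2
    rw [det_fin_two, hrow.1, hrow.2] at hdet
    simp at hdet
  rw [toSphere, if_neg hden, UpperHalfPlane.coe_specialLinearGroup_apply]
  rfl

/-- A vector spanning the line that corresponds to a point of the boundary circle. -/
def boundaryVec (ξ : OnePoint ℝ) : Fin 2 → ℝ := ξ.elim ![1, 0] fun t => ![t, 1]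

theorem boundaryVec_ne_zero (ξ : OnePoint ℝ) : boundaryVec ξ ≠ 0 := fun h => by
  induction ξ using OnePoint.rec with
  | infty => exact one_ne_zero (congrFun h 0)
  | coe t => exact one_ne_zero (congrFun h 1)

theorem map_ofReal_eq_toSphere (ξ : OnePoint ℝ) :
    OnePoint.map (fun t : ℝ => (t : ℂ)) ξ = toSphere fun i => boundaryVec ξ i := by
  induction ξ using OnePoint.rec <;> simp [toSphere, boundaryVec]

theorem eq_of_area_boundaryVec_eq_zero {ξ η : OnePoint ℝ}
    (h : area (boundaryVec ξ) (boundaryVec η) = 0) : ξ = η := by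
  induction ξ using OnePoint.rec <;> induction η using OnePoint.rec <;>
    simp_all [area, boundaryVec, sub_eq_zero]

theorem finite_setOf_area_boundaryVec_eq_zero {u : Fin 2 → ℝ} (hu : u ≠ 0) :
    {ξ | area (boundaryVec ξ) u = 0}.Finite :=
  Set.Subsingleton.finite fun ξ hξ η hη => eq_of_area_boundaryVec_eq_zero <|
    area_eq_zero_trans hu (by rw [area_swap, hξ, neg_zero]) (by rw [area_swap, hη, neg_zero])

theorem toSphere_mobiusVec_eq_iff {P : Matrix (Fin 2) (Fin 2) ℝ} (hP : P ≠ 0) (z : ℍ)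
    (ξ : OnePoint ℝ) :
    toSphere (mobiusVec P z) = OnePoint.map (fun t : ℝ => (t : ℂ)) ξ ↔
      ∀ x, area (boundaryVec ξ) (P *ᵥ x) = 0 := by
  have hξ : (fun i => (boundaryVec ξ i : ℂ)) ≠ 0 := fun h =>
    boundaryVec_ne_zero ξ (funext fun i => Complex.ofReal_eq_zero.1 (congrFun h i))
  have harea : area (fun i => (boundaryVec ξ i : ℂ)) (mobiusVec P z) =
      (area (boundaryVec ξ) (P.col 0) : ℝ) * (z : ℂ) + (area (boundaryVec ξ) (P.col 1) : ℝ) := by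
    simp only [area, mobiusVec, col_apply, Complex.ofReal_sub, Complex.ofReal_mul]
    ring
  have hcol (x) : P *ᵥ x = x 0 • P.col 0 + x 1 • P.col 1 := by
    simp only [mulVec_eq_sum, Fin.sum_univ_two, op_smul_eq_smul]
    rfl
  rw [map_ofReal_eq_toSphere, eq_comm, toSphere_eq_toSphere_iff hξ (mobiusVec_ne_zero hP z),
    harea, ofReal_mul_add_ofReal_eq_zero_iff]
  simp only [hcol, area_add_right, area_smul_right]
  refine ⟨fun h x => by rw [h.1, h.2, mul_zero, mul_zero, add_zero], fun h => ⟨?_, ?_⟩⟩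
  · simpa using h ![1, 0]
  · simpa using h ![0, 1]

theorem exists_tendsto_norm_inv_smul {V ι : Type*} [NormedAddCommGroup V] [NormedSpace ℝ V]
    [ProperSpace V] (U : Ultrafilter ι) {x : ι → V} (hx : ∀ i, x i ≠ 0) :
    ∃ y ≠ 0, Tendsto (fun i => ‖x i‖⁻¹ • x i) U (𝓝 y) := by
  have hsphere (i) : ‖x i‖⁻¹ • x i ∈ Metric.sphere (0 : V) 1 := by
    rw [mem_sphere_zero_iff_norm, norm_smul, norm_inv, norm_norm,
      inv_mul_cancel₀ (norm_ne_zero_iff.2 (hx i))]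
  obtain ⟨y, hy, hlim⟩ := (isCompact_sphere (0 : V) 1).ultrafilter_le_nhds
    (U.map fun i => ‖x i‖⁻¹ • x i) (le_principal_iff.2 (mem_map.2 (univ_mem' hsphere)))
  exact ⟨y, ne_zero_of_mem_unit_sphere ⟨y, hy⟩, hlim⟩

/-- The closure of the cone over a group of matrices. Its nonzero elements of determinant zero
describe the accumulation of the orbits of the group at the boundary circle. -/
def matrixCone (H : Subgroup SL(2, ℝ)) : Set (Matrix (Fin 2) (Fin 2) ℝ) :=
  closure {M | ∃ c : ℝ, ∃ g ∈ H, M = c • g.1}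

open scoped Matrix.Norms.Elementwise in
theorem exists_mem_matrixCone_of_mem_limitSet {H : Subgroup SL(2, ℝ)} {ξ : OnePoint ℝ}
    (hξ : ξ ∈ limitSet H) :
    ∃ P ∈ matrixCone H, P ≠ 0 ∧ ∀ x, area (boundaryVec ξ) (P *ᵥ x) = 0 := by
  obtain ⟨z, hz⟩ := hξ
  have horbit : (fun w : ℍ => ((w : ℂ) : OnePoint ℂ)) '' MulAction.orbit H z =
      range fun g : H => toSphere (mobiusVec (g : SL(2, ℝ)).1 z) := by
    simp only [← coe_smul_eq_toSphere]
    exact (range_comp _ _).symm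
  rw [horbit] at hz
  obtain ⟨U, hU⟩ : ∃ U : Ultrafilter H,
      Tendsto (fun g : H => toSphere (mobiusVec (g : SL(2, ℝ)).1 z)) U
        (𝓝 (OnePoint.map (fun t : ℝ => (t : ℂ)) ξ)) := by
    have := comap_neBot_iff_frequently.2 (mem_closure_iff_frequently.1 hz)
    exact ⟨Ultrafilter.of _, tendsto_comap.mono_left (Ultrafilter.of_le _)⟩
  have hne (g : H) : g.1.1 ≠ 0 := fun h => by simpa [h] using g.1.2
  obtain ⟨P, hP, hlim⟩ := exists_tendsto_norm_inv_smul U hne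
  refine ⟨P, mem_closure_of_tendsto hlim (univ_mem' fun g : H => ⟨_, g.1, g.2, rfl⟩),
    hP, (toSphere_mobiusVec_eq_iff hP z ξ).1 (tendsto_nhds_unique ?_ hU)⟩
  refine ((continuousAt_toSphere (mobiusVec_ne_zero hP z)).tendsto.comp
    (((continuous_mobiusVec z).tendsto P).comp hlim)).congr fun g => ?_
  have hc : ((‖g.1.1‖⁻¹ : ℝ) : ℂ) ≠ 0 := by
    exact_mod_cast inv_ne_zero (norm_ne_zero_iff.2 (hne g))
  simp only [Function.comp_apply, mobiusVec_smul, toSphere_smul hc]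

theorem mem_limitSet_of_mem_matrixCone {H : Subgroup SL(2, ℝ)} {ξ : OnePoint ℝ}
    {P : Matrix (Fin 2) (Fin 2) ℝ} (hP : P ∈ matrixCone H) (hP0 : P ≠ 0)
    (hξ : ∀ x, area (boundaryVec ξ) (P *ᵥ x) = 0) : ξ ∈ limitSet H := by
  refine ⟨UpperHalfPlane.I, ?_⟩
  rw [← (toSphere_mobiusVec_eq_iff hP0 UpperHalfPlane.I ξ).2 hξ]
  have hcont : ContinuousAt (fun M => toSphere (mobiusVec M UpperHalfPlane.I)) P :=
    ContinuousAt.comp (f := fun M => mobiusVec M UpperHalfPlane.I)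
      (continuousAt_toSphere (mobiusVec_ne_zero hP0 _)) (continuous_mobiusVec _).continuousAt
  have hcone : P ∈ closure ({M | ∃ c : ℝ, ∃ g ∈ H, M = c • g.1} ∩ {0}ᶜ) :=
    isOpen_compl_singleton.closure_inter ⟨hP, hP0⟩
  refine closure_mono ?_ (hcont.continuousWithinAt.mem_closure_image hcone)
  rintro _ ⟨_, ⟨⟨c, g, hg, rfl⟩, hc⟩, rfl⟩
  have hc' : (c : ℂ) ≠ 0 := by
    rintro h
    exact hc (by simp [Complex.ofReal_eq_zero.1 h])
  refine ⟨g • UpperHalfPlane.I, ⟨⟨g, hg⟩, rfl⟩, (coe_smul_eq_toSphere g _).trans ?_⟩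
  simp only [mobiusVec_smul, toSphere_smul hc']

theorem mem_limitSet_iff {H : Subgroup SL(2, ℝ)} {ξ : OnePoint ℝ} :
    ξ ∈ limitSet H ↔
      ∃ P ∈ matrixCone H, P ≠ 0 ∧ ∀ x, area (boundaryVec ξ) (P *ᵥ x) = 0 :=
  ⟨exists_mem_matrixCone_of_mem_limitSet,
    fun ⟨_, hP, hP0, hξ⟩ => mem_limitSet_of_mem_matrixCone hP hP0 hξ⟩

end Fuchsian

namespace Fuchsian

open Matrix Plane

variable {Γ N : Subgroup SL(2, ℝ)}

theorem limitSet_mono (h : N ≤ Γ) : limitSet N ⊆ limitSet Γ := by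
  rintro ξ ⟨z, hz⟩
  refine ⟨z, closure_mono (image_mono ?_) hz⟩
  rintro _ ⟨g, rfl⟩
  exact ⟨⟨g, h g.2⟩, rfl⟩

theorem limitSet_eq_of_relIndex_ne_zero (h : N ≤ Γ) (hfin : N.relIndex Γ ≠ 0) :
    limitSet N = limitSet Γ := by
  refine (limitSet_mono h).antisymm ?_
  rintro ξ ⟨z, hz⟩
  have : (N.subgroupOf Γ).FiniteIndex := ⟨hfin⟩
  obtain ⟨T, hT, -⟩ := (N.subgroupOf Γ).exists_isComplement_right 1
  have hsub : (fun w : ℍ => ((w : ℂ) : OnePoint ℂ)) '' MulAction.orbit Γ z ⊆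
      ⋃ t ∈ T, (fun w : ℍ => ((w : ℂ) : OnePoint ℂ)) '' MulAction.orbit N (t • z) := by
    rintro _ ⟨_, ⟨g, rfl⟩, rfl⟩
    obtain ⟨⟨n, t⟩, rfl⟩ := hT.2 g
    refine mem_biUnion t.2 (mem_image_of_mem _ ⟨⟨n.1, n.2⟩, ?_⟩)
    exact (mul_smul n.1.1 t.1.1 z).symm
  have hz' := closure_mono hsub hz
  rw [hT.finite_right.closure_biUnion, mem_iUnion₂] at hz'
  obtain ⟨t, -, ht⟩ := hz'
  exact ⟨_, ht⟩

theorem exists_mulVec_ne_zero {M : Matrix (Fin 2) (Fin 2) ℝ} (hM : M ≠ 0) :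
    ∃ x, M *ᵥ x ≠ 0 := by
  by_contra! h
  exact hM (Matrix.ext_of_mulVec_single fun i => by rw [h, zero_mulVec])

theorem det_eq_zero_of_forall_area_eq_zero {P : Matrix (Fin 2) (Fin 2) ℝ} {u : Fin 2 → ℝ}
    (hu : u ≠ 0) (h : ∀ x, area u (P *ᵥ x) = 0) : P.det = 0 := by
  have harea := area_mulVec P ![1, 0] ![0, 1]
  rw [area_eq_zero_trans hu (h _) (h _)] at harea
  simpa [area] using harea.symm

/- If `A` is a limit of multiples of `g i ∈ Γ` and `n ∈ N`, then `A * n * adj A` is a limit of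
multiples of the conjugates `g i * n * (g i)⁻¹ ∈ N`. Its range lies in the range of `A`, and it is
nonzero as soon as `n` moves the kernel of `A`. -/
theorem limitSet_subset_of_le_normalizer (hN : Γ ≤ Subgroup.normalizer N)
    (hfix : ∀ u : Fin 2 → ℝ, u ≠ 0 → ∃ n ∈ N, area u (n.1 *ᵥ u) ≠ 0) :
    limitSet Γ ⊆ limitSet N := by
  intro ξ hξ
  rw [mem_limitSet_iff] at hξ ⊢
  obtain ⟨A, hA, hA0, hrange⟩ := hξ
  have hcone : ∀ n ∈ N, A * n.1 * A.adjugate ∈ matrixCone N := by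
    intro n hn
    refine map_mem_closure (f := fun B : Matrix (Fin 2) (Fin 2) ℝ => B * n.1 * B.adjugate)
      (by fun_prop) hA ?_
    rintro _ ⟨c, g, hg, rfl⟩
    refine ⟨c * c, g * n * g⁻¹, (Subgroup.mem_normalizer_iff.1 (hN hg) n).1 hn, ?_⟩
    have hconj : (g * n * g⁻¹).1 = g.1 * n.1 * g.1.adjugate := rfl
    simp only [hconj, adjugate_smul, Fintype.card_fin, Nat.add_one_sub_one, pow_one,
      smul_mul_assoc, mul_smul_comm, smul_smul]
  have hadj : A.adjugate ≠ 0 := fun h => hA0 <| by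
    have hAA := A.adjugate_adjugate'
    rwa [h, adjugate_zero, Fintype.card_fin, pow_zero, one_smul, eq_comm] at hAA
  obtain ⟨x, hx⟩ := exists_mulVec_ne_zero hadj
  have hker : A *ᵥ (A.adjugate *ᵥ x) = 0 := by
    rw [mulVec_mulVec, mul_adjugate,
      det_eq_zero_of_forall_area_eq_zero (boundaryVec_ne_zero ξ) hrange, zero_smul, zero_mulVec]
  obtain ⟨n, hn, hne⟩ := hfix _ hx
  refine ⟨A * n.1 * A.adjugate, hcone n hn, fun h => hA0 ?_, fun y => ?_⟩
  · refine matrix_ext_of_area_ne_zero hne (by rw [hker, zero_mulVec]) ?_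
    simp only [mulVec_mulVec, ← mul_assoc, h, zero_mulVec, zero_mul]
  · rw [← mulVec_mulVec, ← mulVec_mulVec]
    exact hrange _

theorem finite_limitSet_of_pair {u v : Fin 2 → ℝ} (huv : area u v ≠ 0)
    (h : ∀ g ∈ Γ, (area u (g.1 *ᵥ u) = 0 ∧ area v (g.1 *ᵥ v) = 0) ∨
      (area v (g.1 *ᵥ u) = 0 ∧ area u (g.1 *ᵥ v) = 0)) : (limitSet Γ).Finite := by
  have hv : v ≠ 0 := left_ne_zero_of_area_ne_zero (v := u) (by rwa [area_swap, neg_ne_zero])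
  have hcone : matrixCone Γ ⊆ {M | (area u (M *ᵥ u) = 0 ∧ area v (M *ᵥ v) = 0) ∨
      (area v (M *ᵥ u) = 0 ∧ area u (M *ᵥ v) = 0)} := by
    have hcont (a b : Fin 2 → ℝ) :
        Continuous fun M : Matrix (Fin 2) (Fin 2) ℝ => area a (M *ᵥ b) := by
      unfold area; fun_prop
    have hclosed (a b : Fin 2 → ℝ) := isClosed_eq (hcont a b) (continuous_const (y := (0 : ℝ)))
    refine closure_minimal ?_
      (((hclosed _ _).inter (hclosed _ _)).union ((hclosed _ _).inter (hclosed _ _)))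
    rintro _ ⟨c, g, hg, rfl⟩
    simp only [mem_ofPred_eq, smul_mulVec, area_smul_right]
    exact (h g hg).imp (fun h => by simp only [h, mul_zero, and_self])
      fun h => by simp only [h, mul_zero, and_self]
  refine ((finite_setOf_area_boundaryVec_eq_zero (left_ne_zero_of_area_ne_zero huv)).union
    (finite_setOf_area_boundaryVec_eq_zero hv)).subset fun ξ hξ => ?_
  obtain ⟨P, hP, hP0, hrange⟩ := mem_limitSet_iff.1 hξ
  have hpar {a b : Fin 2 → ℝ} (hb : P *ᵥ b ≠ 0) (hab : area a (P *ᵥ b) = 0) :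
      area (boundaryVec ξ) a = 0 :=
    area_eq_zero_trans hb (by rw [area_swap, hrange, neg_zero]) (by rw [area_swap, hab, neg_zero])
  have hne : P *ᵥ u ≠ 0 ∨ P *ᵥ v ≠ 0 := by
    by_contra! hcon
    exact hP0 (matrix_ext_of_area_ne_zero huv (by simp [hcon]) (by simp [hcon]))
  rcases hcone hP with ⟨hu, hv⟩ | ⟨hu, hv⟩ <;> rcases hne with hPu | hPv
  exacts [Or.inl (hpar hPu hu), Or.inr (hpar hPv hv), Or.inr (hpar hPu hu), Or.inl (hpar hPv hv)]

/- The hypothesis says that `u` is an eigenvector with eigenvalue `±1`. In this form it is linear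
in `g`, so it passes to the closed cone. -/
theorem finite_limitSet_of_parabolic {u : Fin 2 → ℝ} (hu : u ≠ 0)
    (h : ∀ g ∈ Γ, (2 : ℝ) • g.1 *ᵥ u = g.1.trace • u) : (limitSet Γ).Finite := by
  have hcone : matrixCone Γ ⊆ {M | (2 : ℝ) • M *ᵥ u = M.trace • u} := by
    refine closure_minimal ?_ (isClosed_eq (by fun_prop) (by fun_prop))
    rintro _ ⟨c, g, hg, rfl⟩
    rw [mem_ofPred_eq, smul_mulVec, trace_smul, smul_comm, h g hg, smul_assoc]
  refine (finite_setOf_area_boundaryVec_eq_zero hu).subset fun ξ hξ => ?_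
  obtain ⟨P, hP, hP0, hrange⟩ := mem_limitSet_iff.1 hξ
  have hPu : (2 : ℝ) • P *ᵥ u = P.trace • u := hcone hP
  by_cases htr : P.trace = 0
  · rw [htr, zero_smul, smul_eq_zero_iff_right two_ne_zero] at hPu
    obtain ⟨x, hx⟩ := exists_mulVec_ne_zero hP0
    have hPPx : P *ᵥ (P *ᵥ x) = 0 := by
      rw [mulVec_mulVec, mul_self_eq_trace_smul_sub_det_smul, htr,
        det_eq_zero_of_forall_area_eq_zero (boundaryVec_ne_zero ξ) hrange, zero_smul, zero_smul,
        sub_zero, zero_mulVec]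
    have hxu : area (P *ᵥ x) u = 0 := by
      by_contra hne
      exact hP0 (matrix_ext_of_area_ne_zero hne (by rw [hPPx, zero_mulVec])
        (by rw [hPu, zero_mulVec]))
    exact area_eq_zero_trans hx (by rw [area_swap, hrange, neg_zero]) hxu
  · have hξu : P.trace * area (boundaryVec ξ) u = 0 := by
      rw [← area_smul_right, ← hPu, area_smul_right, hrange, mul_zero]
    exact (mul_eq_zero.1 hξu).resolve_left htr

end Fuchsian

/-! ### Normal subgroups of Fuchsian groups -/

namespace Plane

open Matrix

theorem exists_pow_eq_smul_add_smul {R : Type*} [CommRing R] (M : Matrix (Fin 2) (Fin 2) R)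
    (k : ℕ) : ∃ p q : R, M ^ k = p • M + q • (1 : Matrix (Fin 2) (Fin 2) R) := by
  induction k with
  | zero => exact ⟨0, 1, by rw [pow_zero, zero_smul, one_smul, zero_add]⟩
  | succ k ih =>
    obtain ⟨p, q, h⟩ := ih
    refine ⟨p * M.trace + q, -(p * M.det), ?_⟩
    rw [pow_succ, h, add_mul, smul_mul_assoc, smul_mul_assoc, one_mul,
      mul_self_eq_trace_smul_sub_det_smul]
    module

theorem det_smul_add_smul_one {R : Type*} [CommRing R] (M : Matrix (Fin 2) (Fin 2) R) (p q : R) :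
    (p • M + q • (1 : Matrix (Fin 2) (Fin 2) R)).det =
      p ^ 2 * M.det + p * q * M.trace + q ^ 2 := by
  simp only [det_fin_two, trace_fin_two, Matrix.add_apply, Matrix.smul_apply, one_apply_eq,
    one_apply_ne (zero_ne_one (α := Fin 2)), one_apply_ne (one_ne_zero (α := Fin 2)), smul_eq_mul]
  ring

theorem pow_mulVec_eq_smul {R : Type*} [CommRing R] {M : Matrix (Fin 2) (Fin 2) R}
    {u : Fin 2 → R} {c : R} (h : M *ᵥ u = c • u) (k : ℕ) : (M ^ k) *ᵥ u = c ^ k • u := by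
  induction k with
  | zero => rw [pow_zero, pow_zero, one_mulVec, one_smul]
  | succ k ih => rw [pow_succ, ← mulVec_mulVec, h, mulVec_smul, ih, smul_smul, ← pow_succ']

variable {K : Type*} [Field K] {g : SL(2, K)} {u v w : Fin 2 → K} {a b c : K}

theorem exists_eq_smul_add_smul (h : area u v ≠ 0) (x : Fin 2 → K) :
    ∃ a b : K, x = a • u + b • v := by
  refine ⟨-((area u v)⁻¹ * area v x), -((area u v)⁻¹ * area x u), ?_⟩
  have hx := area_smul_add_area_smul_add_area_smul u v x
  rw [add_comm, ← eq_neg_iff_add_eq_zero, ← eq_inv_smul_iff₀ h] at hx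
  exact hx.trans (by module)

theorem inv_mulVec_eq_smul (hc : c ≠ 0) (h : g.1 *ᵥ u = c • u) :
    (g⁻¹).1 *ᵥ u = c⁻¹ • u := by
  have hg : (g⁻¹).1 * g.1 = 1 := congrArg Subtype.val (inv_mul_cancel g)
  rw [eq_inv_smul_iff₀ hc, ← mulVec_smul, ← h, mulVec_mulVec, hg, one_mulVec]

theorem sq_sub_trace_mul_add_one_eq_zero (hu : u ≠ 0) (h : g.1 *ᵥ u = c • u) :
    c ^ 2 - g.1.trace * c + 1 = 0 := by
  linear_combination exists_mulVec_eq_smul_iff.1 ⟨u, hu, h⟩ - g.2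

theorem eigenvalue_ne_zero (hu : u ≠ 0) (h : g.1 *ᵥ u = c • u) : c ≠ 0 := by
  rintro rfl
  simpa using sq_sub_trace_mul_add_one_eq_zero hu h

theorem trace_eq_add_inv (hu : u ≠ 0) (h : g.1 *ᵥ u = c • u) : g.1.trace = c + c⁻¹ := by
  have hc := eigenvalue_ne_zero hu h
  field_simp
  linear_combination -sq_sub_trace_mul_add_one_eq_zero hu h

theorem area_ne_zero_of_eigenvalue_ne (hu : u ≠ 0) (hv : v ≠ 0) (hgu : g.1 *ᵥ u = a • u)
    (hgv : g.1 *ᵥ v = b • v) (hab : a ≠ b) : area u v ≠ 0 := fun h => by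
  obtain ⟨r, rfl⟩ := (area_eq_zero_iff hu).1 h
  rw [mulVec_smul, hgu, smul_comm] at hgv
  exact hab (smul_left_injective K hv hgv)

theorem exists_eigenvector_inv (hu : u ≠ 0) (h : g.1 *ᵥ u = c • u) (hc : c ^ 2 ≠ 1) :
    ∃ v, area u v ≠ 0 ∧ g.1 *ᵥ v = c⁻¹ • v := by
  have hc0 := eigenvalue_ne_zero hu h
  obtain ⟨v, hv, hgv⟩ : ∃ v, v ≠ 0 ∧ g.1 *ᵥ v = c⁻¹ • v := by
    rw [exists_mulVec_eq_smul_iff, trace_eq_add_inv hu h, g.2]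
    field_simp
    ring
  refine ⟨v, area_ne_zero_of_eigenvalue_ne hu hv h hgv fun hcc => hc ?_, hgv⟩
  rw [pow_two]
  nth_rw 2 [hcc]
  exact mul_inv_cancel₀ hc0

/- If neither area vanishes, then comparing `area u w` and `area v w` with their images under `g`
shows that the eigenvalue of `w` is inverse to both `a` and `b`. -/
theorem area_eq_zero_or_area_eq_zero (hgu : g.1 *ᵥ u = a • u) (hgv : g.1 *ᵥ v = b • v)
    (hab : a ≠ b) (hw : w ≠ 0) (hgw : area w (g.1 *ᵥ w) = 0) : area u w = 0 ∨ area v w = 0 := by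
  obtain ⟨c, hc⟩ := (area_eq_zero_iff hw).1 hgw
  have hmul {x : Fin 2 → K} {r : K} (hx : g.1 *ᵥ x = r • x) (h0 : area x w ≠ 0) : c * r = 1 := by
    have harea := area_specialLinearGroup_mulVec g x w
    rw [hx, hc, area_smul_right, area_swap, area_smul_right, area_swap w x] at harea
    exact mul_right_cancel₀ h0 (by linear_combination harea)
  by_contra! hne
  have hcab := (hmul hgu hne.1).trans (hmul hgv hne.2).symm
  exact hab (mul_left_cancel₀ (left_ne_zero_of_mul_eq_one (hmul hgu hne.1)) hcab)

theorem mem_center_of_eigenvectors (huv : area u v ≠ 0) (hu : g.1 *ᵥ u = c • u)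
    (hv : g.1 *ᵥ v = c • v) : g ∈ Subgroup.center SL(2, K) := by
  have hg : g.1 = c • (1 : Matrix (Fin 2) (Fin 2) K) := by
    apply matrix_ext_of_area_ne_zero huv <;> simpa only [smul_mulVec, one_mulVec]
  refine Matrix.SpecialLinearGroup.mem_center_iff.2 ⟨c, ?_, ?_⟩
  · rw [← g.2, hg, Matrix.det_smul, det_one, mul_one]
  · exact (smul_one_eq_diagonal c).symm.trans hg.symm

theorem exists_conj_pow_eq_add_smul (huv : area u v ≠ 0) {h : SL(2, K)} {a r s : K} (hc : c ≠ 0)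
    (hgu : g.1 *ᵥ u = c • u) (hgv : g.1 *ᵥ v = c⁻¹ • v) (hhu : h.1 *ᵥ u = a • u)
    (hhv : h.1 *ᵥ v = r • u + s • v) :
    ∃ D E : Matrix (Fin 2) (Fin 2) K, E *ᵥ v = r • u ∧
      ∀ k : ℕ, (g ^ k * h * (g ^ k)⁻¹).1 = D + (c ^ 2) ^ k • E := by
  obtain ⟨D, hDu, hDv⟩ := exists_mulVec_eq huv (a • u) (s • v)
  obtain ⟨E, hEu, hEv⟩ := exists_mulVec_eq huv 0 (r • u)
  refine ⟨D, E, hEv, fun k => ?_⟩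
  have hck : c ^ k ≠ 0 := pow_ne_zero k hc
  have hpu : (g ^ k).1 *ᵥ u = c ^ k • u := pow_mulVec_eq_smul hgu k
  have hpv : (g ^ k).1 *ᵥ v = c⁻¹ ^ k • v := pow_mulVec_eq_smul hgv k
  have hcoe : (g ^ k * h * (g ^ k)⁻¹).1 = (g ^ k).1 * h.1 * ((g ^ k)⁻¹).1 := rfl
  refine matrix_ext_of_area_ne_zero huv ?_ ?_ <;>
    simp only [hcoe, ← mulVec_mulVec, add_mulVec, smul_mulVec]
  · rw [inv_mulVec_eq_smul hck hpu, mulVec_smul, hhu, mulVec_smul, mulVec_smul, hpu, hDu, hEu,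
      smul_zero, add_zero, smul_comm a, inv_smul_smul₀ hck]
  · rw [inv_mulVec_eq_smul (pow_ne_zero k (inv_ne_zero hc)) hpv, mulVec_smul, hhv, mulVec_smul,
      mulVec_add, mulVec_smul, mulVec_smul, hpu, hpv, hDv, hEv, inv_pow, inv_inv]
    simp only [smul_add, smul_smul]
    rw [add_comm]
    congr 2 <;> field_simp
    ring

end Plane

namespace Fuchsian

open Matrix Plane

variable {Γ N : Subgroup SL(2, ℝ)}

theorem finite_setOf_mem_of_isCompact (hΓ : DiscreteTopology Γ) {K : Set (Matrix (Fin 2) (Fin 2) ℝ)}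
    (hK : IsCompact K) : {g | g ∈ Γ ∧ g.1 ∈ K}.Finite := by
  have hclosed : IsClosed (Γ : Set SL(2, ℝ)) := Subgroup.isClosed_of_discrete
  have hemb : IsClosedEmbedding fun g : SL(2, ℝ) => g.1 :=
    (isClosed_eq (continuous_id.matrix_det) continuous_const).isClosedEmbedding_subtypeVal
  have hcomp : IsCompact ((Γ : Set SL(2, ℝ)) ∩ (fun g : SL(2, ℝ) => g.1) ⁻¹' K) :=
    (hemb.isCompact_preimage hK).inter_left hclosed
  exact hcomp.finite (IsDiscrete.mono ⟨hΓ⟩ inter_subset_left)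

theorem isOfFinOrder_of_trace_sq_lt (hΓ : DiscreteTopology Γ) {g : SL(2, ℝ)} (hg : g ∈ Γ)
    (htr : g.1.trace ^ 2 < 4) : IsOfFinOrder g := by
  let e : ℝ × ℝ → Matrix (Fin 2) (Fin 2) ℝ := fun x => x.1 • g.1 + x.2 • 1
  set C : ℝ := 4 / (4 - g.1.trace ^ 2) + 1
  have hC : 0 < C := by have := sub_pos.2 htr; positivity
  have hK : IsCompact (e '' (Icc (-C) C ×ˢ Icc (-C) C)) :=
    (isCompact_Icc.prod isCompact_Icc).image (by fun_prop)
  refine finite_powers.1 ((finite_setOf_mem_of_isCompact hΓ hK).subset ?_)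
  rintro _ ⟨k, rfl⟩
  refine ⟨Γ.pow_mem hg k, ?_⟩
  obtain ⟨p, q, hpq⟩ := exists_pow_eq_smul_add_smul g.1 k
  have hquad : p ^ 2 + p * q * g.1.trace + q ^ 2 = 1 := by
    have hdet := det_smul_add_smul_one g.1 p q
    rwa [← hpq, det_pow, g.2, one_pow, mul_one, eq_comm] at hdet
  have hbound {x y : ℝ} (h : x ^ 2 + x * y * g.1.trace + y ^ 2 = 1) : x ∈ Icc (-C) C := by
    have hx : x ^ 2 ≤ 4 / (4 - g.1.trace ^ 2) := by
      rw [le_div_iff₀ (sub_pos.2 htr)]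
      linear_combination sq_nonneg (2 * y + x * g.1.trace) + 4 * h
    exact abs_le.1 (abs_le_of_sq_le_sq (by nlinarith) hC.le)
  exact ⟨(p, q), ⟨hbound hquad, hbound (x := q) (y := p) (by linear_combination hquad)⟩, hpq.symm⟩

theorem exists_eigenvector_of_le_trace_sq {g : SL(2, ℝ)} (htr : 4 ≤ g.1.trace ^ 2) :
    ∃ u : Fin 2 → ℝ, u ≠ 0 ∧ ∃ c : ℝ, g.1 *ᵥ u = c • u := by
  have hroot := Real.sq_sqrt (sub_nonneg.2 htr)
  obtain ⟨u, hu, hgu⟩ := (exists_mulVec_eq_smul_iff (M := g.1)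
    (c := (g.1.trace + √(g.1.trace ^ 2 - 4)) / 2)).2
      (by rw [g.2]; linear_combination hroot / 4)
  exact ⟨u, hu, _, hgu⟩

/- Write `h v = r • u + s • v`. The conjugates of `h` by the powers of `g` agree with `h` on `u` and
send `v` to `(c ^ 2) ^ k * r • u + s • v`. They stay in a compact set, so only finitely many of them
are distinct; hence `r = 0`. -/
theorem area_mulVec_eq_zero_of_contraction (hΓ : DiscreteTopology Γ) {u v : Fin 2 → ℝ}
    (huv : area u v ≠ 0) {g h : SL(2, ℝ)} (hg : g ∈ Γ) {c : ℝ} (hc0 : c ≠ 0) (hc : |c| < 1)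
    (hgu : g.1 *ᵥ u = c • u) (hgv : g.1 *ᵥ v = c⁻¹ • v) (hh : h ∈ Γ)
    (hhu : area u (h.1 *ᵥ u) = 0) : area v (h.1 *ᵥ v) = 0 := by
  obtain ⟨a, ha⟩ := (area_eq_zero_iff (left_ne_zero_of_area_ne_zero huv)).1 hhu
  obtain ⟨r, s, hrs⟩ := exists_eq_smul_add_smul huv (h.1 *ᵥ v)
  obtain ⟨D, E, hEv, hconj⟩ := exists_conj_pow_eq_add_smul huv hc0 hgu hgv ha hrs
  have hc2 : c ^ 2 < 1 := (sq_lt_one_iff_abs_lt_one c).2 hc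
  have hfinite := finite_setOf_mem_of_isCompact hΓ
    (isCompact_Icc.image (f := fun t : ℝ => D + t • E) (s := Icc 0 1) (by fun_prop))
  have hmem (k : ℕ) : g ^ k * h * (g ^ k)⁻¹ ∈
      {f | f ∈ Γ ∧ f.1 ∈ (fun t : ℝ => D + t • E) '' Icc 0 1} :=
    ⟨Γ.mul_mem (Γ.mul_mem (Γ.pow_mem hg k) hh) (Γ.inv_mem (Γ.pow_mem hg k)),
      (c ^ 2) ^ k, ⟨by positivity, pow_le_one₀ (sq_nonneg c) hc2.le⟩, (hconj k).symm⟩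
  obtain ⟨k, -, l, -, hkl, heq⟩ :=
    infinite_univ.exists_ne_map_eq_of_mapsTo (fun k _ => hmem k) hfinite
  have hr : ((c ^ 2) ^ k - (c ^ 2) ^ l) • r • u = 0 := by
    have hE := (hconj k).symm.trans ((congrArg Subtype.val heq).trans (hconj l))
    rw [add_left_cancel_iff, ← sub_eq_zero, ← sub_smul] at hE
    rw [← hEv, ← smul_mulVec, hE, zero_mulVec]
  have hne : (c ^ 2) ^ k - (c ^ 2) ^ l ≠ 0 := sub_ne_zero.2 fun h =>
    hkl ((pow_right_strictAnti₀ (by positivity) hc2).injective h)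
  rw [hrs, (smul_eq_zero.1 hr).resolve_left hne, zero_add, area_smul_right, area_self, mul_zero]

theorem finite_limitSet_of_fixed (hΓ : DiscreteTopology Γ) {u : Fin 2 → ℝ} (hu : u ≠ 0)
    (h : ∀ g ∈ Γ, area u (g.1 *ᵥ u) = 0) : (limitSet Γ).Finite := by
  by_cases hpar : ∀ g ∈ Γ, ∀ c : ℝ, g.1 *ᵥ u = c • u → c ^ 2 = 1
  · refine finite_limitSet_of_parabolic hu fun g hg => ?_
    obtain ⟨c, hc⟩ := (area_eq_zero_iff hu).1 (h g hg)
    have hinv : c⁻¹ = c := inv_eq_of_mul_eq_one_left (by rw [← pow_two, hpar g hg c hc])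
    rw [hc, trace_eq_add_inv hu hc, hinv, smul_smul, two_mul]
  · push Not at hpar
    obtain ⟨g, hg, c, hgu, hc⟩ := hpar
    have hc0 := eigenvalue_ne_zero hu hgu
    obtain ⟨v, huv, hgv⟩ := exists_eigenvector_inv hu hgu hc
    refine finite_limitSet_of_pair huv fun f hf => Or.inl ⟨h f hf, ?_⟩
    rcases lt_or_gt_of_ne fun habs : |c| = 1 => hc (by rw [← sq_abs, habs, one_pow]) with hlt | hgt
    · exact area_mulVec_eq_zero_of_contraction hΓ huv hg hc0 hlt hgu hgv hf (h f hf)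
    · refine area_mulVec_eq_zero_of_contraction hΓ huv (Γ.inv_mem hg) (inv_ne_zero hc0) ?_
        (inv_mulVec_eq_smul hc0 hgu) (inv_mulVec_eq_smul (inv_ne_zero hc0) hgv) hf (h f hf)
      rw [abs_inv]
      exact inv_lt_one_of_one_lt₀ hgt

theorem area_mulVec_eq_zero_of_mem_normalizer {g : SL(2, ℝ)}
    (hg : g ∈ Subgroup.normalizer (N : Set SL(2, ℝ))) {u : Fin 2 → ℝ}
    (hu : ∀ n ∈ N, area u (n.1 *ᵥ u) = 0) :
    ∀ n ∈ N, area (g.1 *ᵥ u) (n.1 *ᵥ (g.1 *ᵥ u)) = 0 := by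
  intro n hn
  have hconj : g⁻¹ * n * g ∈ N := by
    rw [Subgroup.mem_normalizer_iff.1 hg]
    simpa only [mul_assoc, mul_inv_cancel_left, mul_inv_cancel, mul_one] using hn
  have hmul : g.1 * (g⁻¹ * n * g).1 = n.1 * g.1 :=
    congrArg Subtype.val (show g * (g⁻¹ * n * g) = n * g by group)
  rw [mulVec_mulVec, ← hmul, ← mulVec_mulVec, area_specialLinearGroup_mulVec]
  exact hu _ hconj

theorem exists_area_mulVec_ne_zero (hΓ : DiscreteTopology Γ) (hinf : (limitSet Γ).Infinite)
    (hN : Γ ≤ Subgroup.normalizer N) (hcenter : ¬ N ≤ Subgroup.center SL(2, ℝ))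
    {u : Fin 2 → ℝ} (hu : u ≠ 0) : ∃ n ∈ N, area u (n.1 *ᵥ u) ≠ 0 := by
  by_contra! hfix
  obtain ⟨g, hg, hgu⟩ : ∃ g ∈ Γ, area u (g.1 *ᵥ u) ≠ 0 := by
    by_contra! hcon
    exact hinf (finite_limitSet_of_fixed hΓ hu hcon)
  set v := g.1 *ᵥ u
  have hv : v ≠ 0 := left_ne_zero_of_area_ne_zero (v := u) (by rwa [area_swap, neg_ne_zero])
  have hfixv := area_mulVec_eq_zero_of_mem_normalizer (hN hg) hfix
  obtain ⟨n, hn, hnc⟩ := SetLike.not_le_iff_exists.1 hcenter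
  obtain ⟨a, ha⟩ := (area_eq_zero_iff hu).1 (hfix n hn)
  obtain ⟨b, hb⟩ := (area_eq_zero_iff hv).1 (hfixv n hn)
  have hab : a ≠ b := by
    rintro rfl
    exact hnc (mem_center_of_eigenvectors hgu ha hb)
  refine hinf (finite_limitSet_of_pair hgu fun h hh => ?_)
  have hne : area (h.1 *ᵥ u) (h.1 *ᵥ v) ≠ 0 := by rwa [area_specialLinearGroup_mulVec]
  have hhu : h.1 *ᵥ u ≠ 0 := left_ne_zero_of_area_ne_zero hne
  have hhv : h.1 *ᵥ v ≠ 0 :=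
    left_ne_zero_of_area_ne_zero (v := h.1 *ᵥ u) (by rwa [area_swap, neg_ne_zero])
  have hline {w : Fin 2 → ℝ} (hw : ∀ n ∈ N, area w (n.1 *ᵥ w) = 0) (hw0 : h.1 *ᵥ w ≠ 0) :=
    area_eq_zero_or_area_eq_zero ha hb hab hw0
      (area_mulVec_eq_zero_of_mem_normalizer (hN hh) hw n hn)
  rcases hline hfix hhu with hu' | hu' <;> rcases hline hfixv hhv with hv' | hv'
  exacts [absurd (area_eq_zero_trans hu hu' hv') hne, Or.inl ⟨hu', hv'⟩, Or.inr ⟨hu', hv'⟩,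
    absurd (area_eq_zero_trans hv hu' hv') hne]

theorem limitSet_eq_of_le_normalizer (hΓ : DiscreteTopology Γ) (hinf : (limitSet Γ).Infinite)
    (hle : N ≤ Γ) (hN : Γ ≤ Subgroup.normalizer N)
    (hcenter : ¬ N ≤ Subgroup.center SL(2, ℝ)) : limitSet N = limitSet Γ :=
  (limitSet_mono hle).antisymm <| limitSet_subset_of_le_normalizer hN fun _ =>
    exists_area_mulVec_ne_zero hΓ hinf hN hcenter

theorem not_le_center_of_ne_bot (htf : ∀ g ∈ N, IsOfFinOrder g → g = 1) (hN : N ≠ ⊥) :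
    ¬ N ≤ Subgroup.center SL(2, ℝ) := by
  refine fun hle => hN ((Subgroup.eq_bot_iff_forall N).2 fun g hg => htf g hg ?_)
  obtain ⟨r, hr, hgr⟩ := Matrix.SpecialLinearGroup.mem_center_iff.1 (hle hg)
  refine isOfFinOrder_iff_pow_eq_one.2 ⟨2, two_pos, Subtype.ext ?_⟩
  have hsq : (g ^ 2).1 = g.1 ^ 2 := rfl
  rw [hsq, ← hgr, ← map_pow, ← Fintype.card_fin 2, hr, map_one]
  rfl

/- Normal subgroups that meet trivially commute, but an element that commutes with a hyperbolic or
parabolic one shares its fixed points. -/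
theorem inf_ne_bot_of_le_normalizer (hΓ : DiscreteTopology Γ) (hinf : (limitSet Γ).Infinite)
    (htf : ∀ g ∈ Γ, IsOfFinOrder g → g = 1) {N₁ N₂ : Subgroup SL(2, ℝ)} (hle₁ : N₁ ≤ Γ)
    (hle₂ : N₂ ≤ Γ) (hN₁ : Γ ≤ Subgroup.normalizer N₁) (hN₂ : Γ ≤ Subgroup.normalizer N₂)
    (hne₁ : N₁ ≠ ⊥) (hne₂ : N₂ ≠ ⊥) : N₁ ⊓ N₂ ≠ ⊥ := by
  intro hbot
  have hcenter₁ := not_le_center_of_ne_bot (fun g hg => htf g (hle₁ hg)) hne₁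
  have hcenter₂ := not_le_center_of_ne_bot (fun g hg => htf g (hle₂ hg)) hne₂
  obtain ⟨n, hn, hnc⟩ := SetLike.not_le_iff_exists.1 hcenter₁
  have htr : 4 ≤ n.1.trace ^ 2 := by
    by_contra! hlt
    exact hnc (htf n (hle₁ hn) (isOfFinOrder_of_trace_sq_lt hΓ (hle₁ hn) hlt) ▸ one_mem _)
  obtain ⟨u, hu, c, hc⟩ := exists_eigenvector_of_le_trace_sq htr
  obtain ⟨m, hm, hmu⟩ := exists_area_mulVec_ne_zero hΓ hinf hN₂ hcenter₂ hu
  have hcomm : n * m = m * n := by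
    rw [← commutatorElement_eq_one_iff_mul_comm, ← Subgroup.mem_bot, ← hbot]
    refine ⟨?_, ?_⟩
    · rw [commutatorElement_def, mul_assoc n, mul_assoc n]
      exact N₁.mul_mem hn ((Subgroup.mem_normalizer_iff.1 (hN₁ (hle₂ hm)) _).1 (N₁.inv_mem hn))
    · exact N₂.mul_mem ((Subgroup.mem_normalizer_iff.1 (hN₂ (hle₁ hn)) m).1 hm) (N₂.inv_mem hm)
  refine hnc (mem_center_of_eigenvectors hmu hc ?_)
  have hcoe : n.1 * m.1 = m.1 * n.1 := congrArg Subtype.val hcomm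
  rw [mulVec_mulVec, hcoe, ← mulVec_mulVec, hc, mulVec_smul]

theorem ne_bot_of_infinite_limitSet (hinf : (limitSet Γ).Infinite) : Γ ≠ ⊥ := by
  rintro rfl
  refine hinf (finite_limitSet_of_fixed Subsingleton.discreteTopology
    (boundaryVec_ne_zero OnePoint.infty) ?_)
  rintro g rfl
  exact (congrArg _ (one_mulVec _)).trans (area_self _)

variable {G : Type*} [Group G] {ρ : G →* SL(2, ℝ)}

theorem range_le_normalizer_map (K : Subgroup G) [K.Normal] :
    ρ.range ≤ Subgroup.normalizer (K.map ρ) := by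
  rw [MonoidHom.range_eq_map, ← Subgroup.normalizer_eq_top K]
  exact Subgroup.le_normalizer_map ρ

theorem iInf_ne_bot_of_normal (hρ : Function.Injective ρ) (hdisc : DiscreteTopology ρ.range)
    (hinf : (limitSet ρ.range).Infinite) (htf : ∀ g : G, IsOfFinOrder g → g = 1)
    {ι : Type*} [Finite ι] {K : ι → Subgroup G} (hnor : ∀ i, (K i).Normal) (hK : ∀ i, K i ≠ ⊥) :
    ⨅ i, K i ≠ ⊥ := by
  have htf' : ∀ g ∈ ρ.range, IsOfFinOrder g → g = 1 := by
    rintro _ ⟨g, rfl⟩ hg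
    rw [htf g (hρ.isOfFinOrder_iff.1 hg), map_one]
  induction ι using Finite.induction_empty_option with
  | of_equiv e ih =>
    rw [← e.iInf_comp]
    exact ih (fun i => hnor (e i)) fun i => hK (e i)
  | h_empty =>
    rw [iInf_of_empty, ← (Subgroup.map_eq_bot_iff_of_injective _ hρ).ne, ← MonoidHom.range_eq_map]
    exact ne_bot_of_infinite_limitSet hinf
  | h_option ih =>
    have hsome := ih (fun i => hnor (some i)) fun i => hK (some i)
    have := hnor none
    have := Subgroup.normal_iInf_normal fun i => hnor (some i)
    rw [iInf_option, ← (Subgroup.map_eq_bot_iff_of_injective _ hρ).ne, Subgroup.map_inf _ _ _ hρ]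
    rw [← (Subgroup.map_eq_bot_iff_of_injective _ hρ).ne] at hsome
    exact inf_ne_bot_of_le_normalizer hdisc hinf htf' (Subgroup.map_le_range _ _)
      (Subgroup.map_le_range _ _) (range_le_normalizer_map _) (range_le_normalizer_map _)
      ((Subgroup.map_eq_bot_iff_of_injective _ hρ).not.2 (hK none)) hsome

theorem limitSet_map_eq_of_normal (hρ : Function.Injective ρ) (hdisc : DiscreteTopology ρ.range)
    (hinf : (limitSet ρ.range).Infinite) (htf : ∀ g : G, IsOfFinOrder g → g = 1)
    {K : Subgroup G} [K.Normal] (hK : K ≠ ⊥) : limitSet (K.map ρ) = limitSet ρ.range := by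
  refine limitSet_eq_of_le_normalizer hdisc hinf (Subgroup.map_le_range _ _)
    (range_le_normalizer_map K) (not_le_center_of_ne_bot ?_
      ((Subgroup.map_eq_bot_iff_of_injective _ hρ).not.2 hK))
  rintro _ ⟨g, -, rfl⟩ hg
  rw [htf g (hρ.isOfFinOrder_iff.1 hg), map_one]

end Fuchsian

/-! ### Subgroups of finite index -/

theorem groupFG_of_finiteIndex {T : Type*} [Group T] (D : Subgroup T) [D.FiniteIndex]
    [hD : Group.FG D] : Group.FG T := by
  let reps : Set T := range fun q : T ⧸ D => q.out
  have htop : D ⊔ Subgroup.closure reps = ⊤ := by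
    refine eq_top_iff.2 fun t _ => ?_
    have hd : (t : T ⧸ D).out⁻¹ * t ∈ D := QuotientGroup.eq.1 (QuotientGroup.out_eq' _)
    have hr : (t : T ⧸ D).out ∈ Subgroup.closure reps := Subgroup.subset_closure ⟨_, rfl⟩
    simpa only [mul_inv_cancel_left] using
      mul_mem (Subgroup.mem_sup_right hr) (Subgroup.mem_sup_left hd)
  rw [Group.fg_def, ← htop]
  exact ((Group.fg_iff_subgroup_fg D).1 hD).sup
    ((Subgroup.fg_iff _).2 ⟨reps, rfl, finite_range _⟩)

theorem finite_monoidHom_of_fg {T M : Type*} [Group T] [Group.FG T] [Monoid M] [Finite M] :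
    Finite (T →* M) := by
  obtain ⟨s, hs, hfin⟩ := Group.fg_iff.1 ‹Group.FG T›
  have := hfin.to_subtype
  exact Finite.of_injective (fun φ : T →* M => s.domRestrict φ) fun φ ψ h =>
    MonoidHom.eq_of_eqOn_dense hs (domRestrict_eq_domRestrict_iff.1 h)

/- A subgroup of index `n` is a point stabilizer of the action on its `n` cosets. -/
theorem finite_setOf_index_eq {T : Type*} [Group T] [Group.FG T] {n : ℕ} (hn : n ≠ 0) :
    {H : Subgroup T | H.index = n}.Finite := by
  have : Finite (T →* Equiv.Perm (Fin n)) := finite_monoidHom_of_fg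
  refine (finite_range fun x : (T →* Equiv.Perm (Fin n)) × Fin n =>
    (MulAction.stabilizer (Equiv.Perm (Fin n)) x.2).comap x.1).subset fun H hH => ?_
  have : H.FiniteIndex := ⟨hH ▸ hn⟩
  let e : T ⧸ H ≃ Fin n := Finite.equivFinOfCardEq hH
  refine ⟨(e.permCongrHom.toMonoidHom.comp (MulAction.toPermHom T (T ⧸ H)),
    e (1 : T)), ?_⟩
  ext t
  change e (t • e.symm (e (1 : T))) = e (1 : T) ↔ t ∈ H
  rw [e.symm_apply_apply, e.apply_eq_iff_eq, ← MulAction.mem_stabilizer_iff,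
    MulAction.stabilizer_quotient]

open scoped Pointwise in
theorem normalizer_eq_comap_stabilizer_conjAct {A : Type*} [Group A] (D : Subgroup A) :
    Subgroup.normalizer (D : Set A) =
      (MulAction.stabilizer (ConjAct A) D).comap (ConjAct.toConjAct (G := A)).toMonoidHom :=
  Subgroup.ext fun _ => Subgroup.mem_normalizer_iff_map_conj_eq

open scoped Pointwise in
theorem finiteIndex_normalizer {A : Type*} [Group A] {T D : Subgroup A} [T.Normal]
    [Group.FG D] (hDT : D ≤ T) (hfin : D.relIndex T ≠ 0) :
    (Subgroup.normalizer (D : Set A)).FiniteIndex := by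
  have : (D.subgroupOf T).FiniteIndex := ⟨hfin⟩
  have : Group.FG (D.subgroupOf T) :=
    Group.fg_of_surjective (f := (Subgroup.subgroupOfEquivOfLe hDT).symm.toMonoidHom)
      (Subgroup.subgroupOfEquivOfLe hDT).symm.surjective
  have : Group.FG T := groupFG_of_finiteIndex (D.subgroupOf T)
  have horbit : (MulAction.orbit (ConjAct A) D).Finite := by
    refine ((finite_setOf_index_eq hfin).image (Subgroup.map T.subtype)).subset ?_
    rintro _ ⟨g, rfl⟩
    have hT : g • T = T := Subgroup.Normal.conjAct ‹T.Normal› g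
    have hle : g • D ≤ T := hT ▸ Subgroup.pointwise_smul_le_pointwise_smul_iff.2 hDT
    refine ⟨(g • D).subgroupOf T, ?_, Subgroup.map_subgroupOf_eq_of_le hle⟩
    calc (g • D).relIndex T = (g • D).relIndex (g • T) := by rw [hT]
      _ = D.relIndex T := Subgroup.relIndex_pointwise_smul g D T
  constructor
  rw [normalizer_eq_comap_stabilizer_conjAct, Subgroup.index_comap_of_surjective _
    (show Function.Surjective (ConjAct.toConjAct (G := A)).toMonoidHom from
      ConjAct.toConjAct.surjective), MulAction.index_stabilizer]
  exact ((ncard_pos horbit).2 (MulAction.nonempty_orbit D)).ne'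

theorem groupFG_of_injective_multiplicative_int {D κ : Type*} [Group D] [Finite κ]
    {Φ : D →* Multiplicative (κ → ℤ)} (hΦ : Function.Injective Φ) : Group.FG D := by
  let φ := MonoidHom.toAdditiveLeft Φ
  have hrange : AddGroup.FG φ.range := by
    rw [AddGroup.fg_iff_addSubgroup_fg, ← AddSubgroup.toIntSubmodule_toAddSubgroup φ.range,
      ← Submodule.fg_iff_addSubgroup_fg]
    exact IsNoetherian.noetherian _
  let e : φ.range ≃+ Additive D := (AddMonoidHom.ofInjective (f := φ) hΦ).symm
  exact GroupFG.iff_add_fg.2 (AddGroup.fg_of_surjective (f := e.toAddMonoidHom) e.surjective)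

open MulAction in
theorem finiteIndex_of_finite_image_orbit {T E B : Type*} [Group T] [MulAction T E]
    {D : Subgroup T} {x : E} [Finite (stabilizer T x)] {π : E → B}
    (hfin : (π '' orbit T x).Finite)
    (hD : ∀ y z, π y = π z → ∃ g ∈ D, g • y = z) : D.FiniteIndex := by
  let F : T ⧸ D → B := fun q => π (q.out⁻¹ • x)
  have hfibre : ∀ q₀ q : T ⧸ D, F q₀ = F q → ∃ s : stabilizer T x, s • q₀ = q := by
    intro q₀ q h
    obtain ⟨g, hg, hgx⟩ := hD _ _ h
    refine ⟨⟨q.out * g * q₀.out⁻¹, ?_⟩, ?_⟩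
    · rw [mem_stabilizer_iff, mul_smul, mul_smul, hgx, smul_inv_smul]
    · have hmk : ((q.out * g * q₀.out⁻¹) • (q₀.out : T ⧸ D)) = q := by
        change (↑(q.out * g * q₀.out⁻¹ * q₀.out) : T ⧸ D) = q
        rw [inv_mul_cancel_right, QuotientGroup.mk_mul_of_mem _ hg, QuotientGroup.out_eq']
      rwa [QuotientGroup.out_eq'] at hmk
  have huniv : (univ : Set (T ⧸ D)).Finite := by
    refine Set.Finite.of_finite_fibers F (hfin.subset ?_) ?_
    · rintro _ ⟨q, -, rfl⟩
      exact mem_image_of_mem π (mem_orbit x q.out⁻¹)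
    · rintro _ ⟨q₀, -, rfl⟩
      exact (finite_range fun s : stabilizer T x => s • q₀).subset fun q hq =>
        hfibre q₀ q hq.2.symm
  have := finite_univ_iff.1 huniv
  exact Subgroup.finiteIndex_of_finite_quotient

open MulAction in
theorem finite_of_finite_orbit {T E : Type*} [Group T] [MulAction T E] {x : E}
    [Finite (stabilizer T x)] (hfin : (orbit T x).Finite) : Finite T := by
  have : (⊥ : Subgroup T).FiniteIndex :=
    finiteIndex_of_finite_image_orbit (π := id) (hfin.image id) fun y z h =>
      ⟨1, one_mem _, (one_smul T y).trans h⟩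
  exact Nat.finite_of_card_ne_zero (Subgroup.index_bot (G := T) ▸ this.index_ne_zero)

/-! ### Translations near cone points -/

theorem isPreconnected_ball_diff_zero (r : ℝ) :
    IsPreconnected (Metric.ball (0 : ℂ) r \ {0}) := by
  rcases le_or_gt r 0 with hr | hr
  · rw [Metric.ball_eq_empty.2 hr, empty_sdiff]
    exact isPreconnected_empty
  have hexp : Complex.exp '' {z | z.re < Real.log r} = Metric.ball (0 : ℂ) r \ {0} := by
    ext z
    rw [mem_sdiff_singleton, mem_ball_zero_iff]
    constructor
    · rintro ⟨y, hy, rfl⟩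
      rw [Complex.norm_exp]
      exact ⟨(Real.lt_log_iff_exp_lt hr).1 hy, Complex.exp_ne_zero y⟩
    · rintro ⟨hz, hz0⟩
      refine ⟨Complex.log z, ?_, Complex.exp_log hz0⟩
      rw [mem_ofPred_eq, Complex.log_re]
      exact Real.log_lt_log (norm_pos_iff.2 hz0) hz
  rw [← hexp]
  exact (convex_halfSpace_re_lt _).isPreconnected.image _ Complex.continuous_exp.continuousOn

theorem eq_of_isPreconnected_of_eventually_eq {α β : Type*} [TopologicalSpace α] {s : Set α}
    (hs : IsPreconnected s) {q : α → β} (hq : ∀ a ∈ s, ∀ᶠ b in 𝓝 a, q b = q a) {a b : α}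
    (ha : a ∈ s) (hb : b ∈ s) : q a = q b :=
  hs.induction₂ (fun a b => q a = q b)
    (fun a ha => ((hq a ha).filter_mono nhdsWithin_le_nhds).mono fun _ => Eq.symm)
    (fun _ _ _ _ _ _ => Eq.trans) (fun _ _ _ _ => Eq.symm) ha hb

theorem apply_eq_apply_zero_of_eventually_eq {β : Type*} [TopologicalSpace β] [T2Space β]
    {q : ℂ → β} {r : ℝ} (hcont : ContinuousAt q 0)
    (hq : ∀ a ∈ Metric.ball 0 r \ {0}, ∀ᶠ b in 𝓝 a, q b = q a) {a : ℂ}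
    (ha : a ∈ Metric.ball 0 r) : q a = q 0 := by
  rcases eq_or_ne a 0 with rfl | ha0
  · rfl
  refine tendsto_nhds_unique (tendsto_const_nhds.congr' ?_)
    (hcont.tendsto.mono_left (nhdsWithin_le_nhds (s := {0}ᶜ)))
  filter_upwards [self_mem_nhdsWithin, nhdsWithin_le_nhds
    (Metric.ball_mem_nhds (0 : ℂ) (Metric.pos_of_mem_ball ha))] with b hb0 hb
  exact eq_of_isPreconnected_of_eventually_eq (isPreconnected_ball_diff_zero r) hq
    ⟨ha, ha0⟩ ⟨hb, hb0⟩

namespace TranslationSurface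

variable {S : Type*} [TopologicalSpace S] {X : TranslationSurface S}

instance : MulAction X.affineGroup S where
  smul g x := g.1.1 x
  one_smul _ := rfl
  mul_smul _ _ _ := rfl

theorem smul_mem_sing_iff (g : X.affineGroup) (x : S) : g • x ∈ X.sing ↔ x ∈ X.sing :=
  g.2.1 x

theorem isAffine_one_of_mem_ker {g : X.affineGroup} (hg : g ∈ X.derivative.ker) :
    X.IsAffine g.1.1 1 :=
  (show g.1.2 = 1 from hg) ▸ g.2

/-- A cone coordinate of exponent `k` centred at `x`: one of the coordinates `w` provided by the
field `cone`, in which the translation charts are `w ^ k + const`. -/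
structure IsConeChart (X : TranslationSurface S) (w : OpenPartialHomeomorph S ℂ) (k : ℕ)
    (x : S) : Prop where
  pos : 0 < k
  mem_source : x ∈ w.source
  map_eq_zero : w x = 0
  source_inter_sing : w.source ∩ X.sing = {x}
  eventually_eq_pow_add : ∀ φ ∈ X.charts, ∀ y ∈ w.source, y ∈ φ.source →
    ∃ c : ℂ, ∀ᶠ z in 𝓝 y, φ z = w z ^ k + c

theorem exists_isConeChart {x : S} (hx : x ∈ X.sing) : ∃ w k, X.IsConeChart w k x := by
  obtain ⟨k, hk, w, hxw, hw0, hws, hw⟩ := X.cone x hx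
  exact ⟨w, k, hk, hxw, hw0, hws, hw⟩

namespace IsConeChart

variable {w : OpenPartialHomeomorph S ℂ} {k : ℕ} {x : S}

theorem symm_zero (hw : X.IsConeChart w k x) : w.symm 0 = x := by
  rw [← hw.map_eq_zero, w.left_inv hw.mem_source]

theorem eventually_iff_exists_ball (hw : X.IsConeChart w k x) {P : S → Prop} :
    (∀ᶠ y in 𝓝 x, P y) ↔
      ∃ r > 0, Metric.ball 0 r ⊆ w.target ∧ ∀ ζ ∈ Metric.ball 0 r, P (w.symm ζ) := by
  rw [← w.eventually_nhds' P hw.mem_source, hw.map_eq_zero]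
  have htarget : w.target ∈ 𝓝 (0 : ℂ) :=
    w.open_target.mem_nhds (hw.map_eq_zero ▸ w.map_source hw.mem_source)
  constructor
  · intro hP
    obtain ⟨r, hr, hsub⟩ := Metric.mem_nhds_iff.1 (inter_mem htarget hP)
    exact ⟨r, hr, fun ζ hζ => (hsub hζ).1, fun ζ hζ => (hsub hζ).2⟩
  · rintro ⟨r, hr, -, hP⟩
    exact mem_of_superset (Metric.ball_mem_nhds 0 hr) hP

theorem symm_notMem_sing (hw : X.IsConeChart w k x) {ζ : ℂ} (hζ : ζ ∈ w.target) (hζ0 : ζ ≠ 0) :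
    w.symm ζ ∉ X.sing := by
  intro hs
  have hx : w.symm ζ = x := hw.source_inter_sing.subset ⟨w.map_target hζ, hs⟩
  exact hζ0 (by rw [← w.right_inv hζ, hx, hw.map_eq_zero])

theorem eventually_pow_sub_pow_eq (hw : X.IsConeChart w k x) {t : S ≃ₜ S} (ht : X.IsAffine t 1)
    {y : S} (hy : y ∈ w.source) (hys : y ∉ X.sing) (hty : t y ∈ w.source) :
    ∀ᶠ z in 𝓝 y, w (t z) ^ k - w z ^ k = w (t y) ^ k - w y ^ k := by
  obtain ⟨φ, hφ, hyφ⟩ := X.exists_chart y hys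
  obtain ⟨ψ, hψ, hyψ⟩ := X.exists_chart (t y) (mt (ht.1 y).1 hys)
  obtain ⟨c, hc⟩ := ht.2 φ hφ ψ hψ y hyφ hyψ
  obtain ⟨a, ha⟩ := hw.eventually_eq_pow_add φ hφ y hy hyφ
  obtain ⟨b, hb⟩ := hw.eventually_eq_pow_add ψ hψ (t y) hty hyψ
  have hconst : ∀ᶠ z in 𝓝 y, w (t z) ^ k - w z ^ k = c + a - b := by
    filter_upwards [hc, ha, t.continuous.continuousAt.eventually hb] with z hcz haz hbz
    rw [planeAct_one] at hcz
    linear_combination hcz - hbz + haz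
  exact hconst.mono fun z hz => hz.trans hconst.self_of_nhds.symm

/- Off the centre `w (t y) ^ k - w y ^ k` is locally constant, by the shape of the translation
charts; it vanishes at the centre, hence on a whole disc. -/
theorem eventually_pow_eq_pow (hw : X.IsConeChart w k x) {t : S ≃ₜ S} (ht : X.IsAffine t 1)
    (hfix : t x = x) : ∀ᶠ y in 𝓝 x, t y ∈ w.source ∧ w (t y) ^ k = w y ^ k := by
  have hsource : w.source ∈ 𝓝 x := w.open_source.mem_nhds hw.mem_source
  have htsource : ∀ᶠ y in 𝓝 x, t y ∈ w.source :=
    t.continuous.continuousAt.eventually_mem (hfix.symm ▸ hsource)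
  obtain ⟨r, hr, hball, htball⟩ := hw.eventually_iff_exists_ball.1 htsource
  let q : S → ℂ := fun y => w (t y) ^ k - w y ^ k
  have hqx : q x = 0 := by simp only [q, hfix, sub_self]
  have hwx : ContinuousAt w x := w.continuousAt hw.mem_source
  have hq : ContinuousAt q x :=
    ((ContinuousAt.comp_of_eq hwx t.continuous.continuousAt hfix).pow k).sub (hwx.pow k)
  have hw0 : ContinuousAt w.symm 0 := w.continuousAt_symm (hball (Metric.mem_ball_self hr))
  refine htsource.and (hw.eventually_iff_exists_ball.2 ⟨r, hr, hball, fun ζ hζ => ?_⟩)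
  have hconst : q (w.symm ζ) = q (w.symm 0) := by
    refine apply_eq_apply_zero_of_eventually_eq (q := q ∘ w.symm)
      (ContinuousAt.comp_of_eq hq hw0 hw.symm_zero) ?_ hζ
    rintro ξ ⟨hξ, hξ0⟩
    exact (w.continuousAt_symm (hball hξ)).eventually (hw.eventually_pow_sub_pow_eq ht
      (w.map_target (hball hξ)) (hw.symm_notMem_sing (hball hξ) hξ0) (htball ξ hξ))
  rw [hw.symm_zero, hqx] at hconst
  exact sub_eq_zero.1 hconst

end IsConeChart

namespace IsAffine

variable {t : S ≃ₜ S}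

theorem eventually_eq_of_fixed (ht : X.IsAffine t 1) {x : S} (hx : x ∉ X.sing) (hfix : t x = x) :
    ∀ᶠ y in 𝓝 x, t y = y := by
  obtain ⟨φ, hφ, hxφ⟩ := X.exists_chart x hx
  obtain ⟨c, hc⟩ := ht.2 φ hφ φ hφ x hxφ (by rwa [hfix])
  have hc0 : c = 0 := by
    have hcx := hc.self_of_nhds
    rwa [planeAct_one, hfix, left_eq_add] at hcx
  have hsource : φ.source ∈ 𝓝 x := φ.open_source.mem_nhds hxφ
  have htsource : ∀ᶠ y in 𝓝 x, t y ∈ φ.source :=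
    t.continuous.continuousAt.eventually_mem (hfix.symm ▸ hsource)
  filter_upwards [hc, hsource, htsource] with y hcy hy hty
  rw [planeAct_one, hc0, add_zero] at hcy
  exact φ.injOn hty hy hcy

/- A punctured disc around the centre is connected, and being fixed by `t` is an open and closed
condition on its (regular) points. -/
theorem eventually_eq_of_isConeChart [T2Space S] (ht : X.IsAffine t 1)
    {w : OpenPartialHomeomorph S ℂ} {k : ℕ} {x : S} (hw : X.IsConeChart w k x) (hfix : t x = x)
    (hcl : ∃ᶠ y in 𝓝 x, y ≠ x ∧ t y = y) : ∀ᶠ y in 𝓝 x, t y = y := by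
  obtain ⟨r, hr, hball, -⟩ :=
    hw.eventually_iff_exists_ball.1 (Eventually.of_forall fun _ => trivial)
  have hnhds : Metric.ball (0 : ℂ) r ∈ 𝓝 (w x) := by
    rw [hw.map_eq_zero]
    exact Metric.ball_mem_nhds 0 hr
  have hnear : ∀ᶠ y in 𝓝 x, y ∈ w.source ∧ w y ∈ Metric.ball 0 r :=
    (w.open_source.eventually_mem hw.mem_source).and
      ((w.continuousAt hw.mem_source).eventually_mem hnhds)
  obtain ⟨y, ⟨hyx, hty⟩, hyw, hyr⟩ := (hcl.and_eventually hnear).exists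
  have hy0 : w y ≠ 0 := fun h => hyx (w.injOn hyw hw.mem_source (h.trans hw.map_eq_zero.symm))
  have hloc : ∀ ζ ∈ Metric.ball 0 r \ {0},
      ∀ᶠ ξ in 𝓝 ζ, (t (w.symm ξ) = w.symm ξ) = (t (w.symm ζ) = w.symm ζ) := by
    rintro ζ ⟨hζ, hζ0⟩
    have hcont := w.continuousAt_symm (hball hζ)
    by_cases hζfix : t (w.symm ζ) = w.symm ζ
    · filter_upwards [hcont.eventually (ht.eventually_eq_of_fixed
        (hw.symm_notMem_sing (hball hζ) hζ0) hζfix)] with ξ hξ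
      exact propext (iff_of_true hξ hζfix)
    · have hopen : IsOpen {z | t z ≠ z} := isOpen_ne_fun t.continuous continuous_id
      filter_upwards [hcont.eventually_mem (hopen.mem_nhds hζfix)] with ξ hξ
      exact propext (iff_of_false hξ hζfix)
  refine hw.eventually_iff_exists_ball.2 ⟨r, hr, hball, fun ζ hζ => ?_⟩
  rcases eq_or_ne ζ 0 with rfl | hζ0
  · rwa [hw.symm_zero]
  · rw [← eq_of_isPreconnected_of_eventually_eq (isPreconnected_ball_diff_zero r) hloc
      ⟨hyr, hy0⟩ ⟨hζ, hζ0⟩, w.left_inv hyw]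
    exact hty

theorem isClosed_setOf_eventually_eq [T2Space S] (ht : X.IsAffine t 1) :
    IsClosed {x | ∀ᶠ y in 𝓝 x, t y = y} := by
  rw [← closure_subset_iff_isClosed]
  intro x hx
  by_contra hxmem
  have hfix : t x = x :=
    closure_minimal (t := {y | t y = y})
      (fun _ hy => Eventually.self_of_nhds (p := fun z => t z = z) hy)
      (isClosed_eq t.continuous continuous_id) hx
  by_cases hsing : x ∈ X.sing
  · obtain ⟨w, k, hw⟩ := exists_isConeChart hsing
    refine hxmem (ht.eventually_eq_of_isConeChart hw hfix ?_)
    refine (mem_closure_iff_frequently.1 hx).mono fun y hy =>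
      ⟨?_, Eventually.self_of_nhds (p := fun z => t z = z) hy⟩
    rintro rfl
    exact hxmem hy
  · exact hxmem (ht.eventually_eq_of_fixed hsing hfix)

theorem eq_one_of_fixed [T2Space S] [PreconnectedSpace S] (ht : X.IsAffine t 1) {x : S}
    (hx : x ∉ X.sing) (hfix : t x = x) : t = 1 := by
  have huniv : {x | ∀ᶠ y in 𝓝 x, t y = y} = univ :=
    IsClopen.eq_univ ⟨ht.isClosed_setOf_eventually_eq, isOpen_setOfPred_eventually_nhds⟩
      ⟨x, ht.eventually_eq_of_fixed hx hfix⟩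
  ext y
  exact Eventually.self_of_nhds (p := fun z => t z = z) (eq_univ_iff_forall.1 huniv y)

end IsAffine

theorem eq_of_smul_eq_smul [T2Space S] [PreconnectedSpace S] {g h : X.affineGroup}
    (hg : g ∈ X.derivative.ker) (hh : h ∈ X.derivative.ker) {x : S} (hx : x ∉ X.sing)
    (hgh : g • x = h • x) : g = h := by
  have hker : h⁻¹ * g ∈ X.derivative.ker := mul_mem (inv_mem hh) hg
  have hfix : (h⁻¹ * g) • x = x := by rw [mul_smul, hgh, inv_smul_smul]
  have hone : (h⁻¹ * g).1.1 = 1 := (isAffine_one_of_mem_ker hker).eq_one_of_fixed hx hfix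
  exact (inv_mul_eq_one.1 (Subtype.ext (Prod.ext hone hker))).symm

/- At a regular point near `x` the cone coordinates of the images under the elements of `F` are
distinct `k`-th roots of the same number. -/
theorem IsConeChart.card_le [T2Space S] [PreconnectedSpace S] {w : OpenPartialHomeomorph S ℂ}
    {k : ℕ} {x : S} (hw : X.IsConeChart w k x)
    (F : Finset (MulAction.stabilizer X.derivative.ker x)) : F.card ≤ k := by
  classical
  have hev : ∀ᶠ y in 𝓝 x, ∀ g ∈ F, g • y ∈ w.source ∧ w (g • y) ^ k = w y ^ k :=
    (eventually_all_finset F).2 fun g _ =>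
      hw.eventually_pow_eq_pow (isAffine_one_of_mem_ker g.1.2) g.2
  obtain ⟨r, hr, hball, hroots⟩ := hw.eventually_iff_exists_ball.1 hev
  obtain ⟨ζ, hζ, hζ0⟩ : ∃ ζ ∈ Metric.ball (0 : ℂ) r, ζ ≠ 0 := by
    refine ⟨(r / 2 : ℝ), ?_, Complex.ofReal_ne_zero.2 (half_pos hr).ne'⟩
    rw [mem_ball_zero_iff, Complex.norm_of_nonneg (half_pos hr).le]
    exact half_lt_self hr
  let y := w.symm ζ
  have hy : y ∉ X.sing := hw.symm_notMem_sing (hball hζ) hζ0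
  calc F.card ≤ (Polynomial.nthRoots k (w y ^ k)).toFinset.card := by
        refine Finset.card_le_card_of_injOn (fun g => w (g • y)) (fun g hg => ?_)
          fun g hg h hh hgh => ?_
        · exact Multiset.mem_toFinset.2
            ((Polynomial.mem_nthRoots hw.pos).2 (hroots ζ hζ g hg).2)
        · exact Subtype.ext (Subtype.ext (eq_of_smul_eq_smul g.1.2 h.1.2 hy
            (w.injOn (hroots ζ hζ g hg).1 (hroots ζ hζ h hh).1 hgh)))
    _ ≤ (Polynomial.nthRoots k (w y ^ k)).card := Multiset.toFinset_card_le _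
    _ ≤ k := Polynomial.card_nthRoots k _

theorem finite_stabilizer_ker [T2Space S] [PreconnectedSpace S] {x : S} (hx : x ∈ X.sing) :
    Finite (MulAction.stabilizer X.derivative.ker x) := by
  obtain ⟨w, k, hw⟩ := exists_isConeChart hx
  by_contra hinf
  have := not_finite_iff_infinite.1 hinf
  obtain ⟨F, hF⟩ :=
    Infinite.exists_subset_card_eq (MulAction.stabilizer X.derivative.ker x) (k + 1)
  exact Nat.not_succ_le_self k (hF.ge.trans (hw.card_le F))

theorem finite_derivative_ker [T2Space S] [PreconnectedSpace S] (hfin : X.sing.Finite)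
    (hsing : X.sing.Nonempty) : Finite X.derivative.ker := by
  obtain ⟨x, hx⟩ := hsing
  have := finite_stabilizer_ker hx
  refine finite_of_finite_orbit (x := x) (hfin.subset ?_)
  rintro _ ⟨g, rfl⟩
  exact (smul_mem_sing_iff g.1 x).2 hx

theorem linearPart_injective [T2Space S] [PreconnectedSpace S] (hfin : X.sing.Finite)
    (hsing : X.sing.Nonempty) {G : Subgroup X.affineGroup}
    (hG : ∀ g : G, IsOfFinOrder g → g = 1) : Function.Injective (linearPart G) := by
  refine (injective_iff_map_eq_one _).2 fun g hg => hG g ?_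
  have := finite_derivative_ker hfin hsing
  have hord := isOfFinOrder_of_finite (⟨g.1, hg⟩ : X.derivative.ker)
  exact G.subtype_injective.isOfFinOrder_iff.1 (X.derivative.ker.subtype.isOfFinOrder hord)

theorem finite_sing [CompactSpace S] (X : TranslationSurface S) : X.sing.Finite := by
  have hopen : IsOpen X.singᶜ := isOpen_iff_mem_nhds.2 fun x hx => by
    obtain ⟨φ, hφ, hxφ⟩ := X.exists_chart x hx
    exact mem_of_superset (φ.open_source.mem_nhds hxφ) (X.disjoint_sing φ hφ).subset_compl_right
  refine (isOpen_compl_iff.1 hopen).isCompact.finite ?_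
  rw [isDiscrete_iff_forall_mem_exists_isOpen]
  intro x hx
  obtain ⟨w, k, hw⟩ := exists_isConeChart hx
  exact ⟨w.source, w.open_source, hw.source_inter_sing⟩

end TranslationSurface

/-! ### Lifting to abelian covers -/

namespace SingularH1

variable {R : Type*} [CommRing R] {E : Type*} [TopologicalSpace E]

/- Fold the simplex, by `x ↦ x 2 - x 1`, onto its two edges at the vertex `0`. -/
theorem exists_simplex_of_edges {γ γ' : C(I, E)} (h : γ 0 = γ' 0) :
    ∃ s : C(stdSimplex ℝ (Fin 3), E),
      s.comp (simplexEdge 0 1) = γ ∧ s.comp (simplexEdge 0 2) = γ' := by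
  let L : C(ℝ, E) :=
    { toFun := fun r => if r ≤ 0 then γ (projIcc 0 1 zero_le_one (-r))
        else γ' (projIcc 0 1 zero_le_one r)
      continuous_toFun := by
        refine Continuous.if_le (by fun_prop) (by fun_prop) continuous_id continuous_const ?_
        rintro r rfl
        rw [neg_zero, projIcc_left]
        exact h }
  have hcoord : ∀ i, Continuous fun x : stdSimplex ℝ (Fin 3) => x.1 i :=
    fun i => (continuous_apply i).comp continuous_subtype_val
  refine ⟨L.comp ⟨fun x => x.1 2 - x.1 1, (hcoord 2).sub (hcoord 1)⟩, ?_, ?_⟩ <;> ext t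
  · simp [L, simplexEdge, t.2.1]
  · rcases eq_or_ne t 0 with rfl | ht
    · simp [L, simplexEdge, h]
    · simp [L, simplexEdge, unitInterval.pos_iff_ne_zero.2 ht]

theorem exists_path_eq_sub {γ γ' : C(I, E)} (h : γ 0 = γ' 0) :
    ∃ δ : C(I, E), δ 0 = γ 1 ∧ δ 1 = γ' 1 ∧
      ∀ c : singularCocycles R E, c.1 δ = c.1 γ' - c.1 γ := by
  obtain ⟨s, rfl, rfl⟩ := exists_simplex_of_edges h
  refine ⟨s.comp (simplexEdge 1 2), congrArg s ?_, congrArg s ?_, fun c => ?_⟩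
  · simp [simplexEdge]
  · simp [simplexEdge]
  · linear_combination c.2 s

theorem apply_const (c : singularCocycles R E) (x : E) : c.1 (ContinuousMap.const I x) = 0 := by
  simpa only [ContinuousMap.const_comp, sub_self, zero_add] using c.2 (ContinuousMap.const _ x)

theorem exists_path_eq_add {γ γ' : C(I, E)} (h : γ 1 = γ' 0) :
    ∃ δ : C(I, E), δ 0 = γ 0 ∧ δ 1 = γ' 1 ∧
      ∀ c : singularCocycles R E, c.1 δ = c.1 γ + c.1 γ' := by
  obtain ⟨r, hr0, hr1, hr⟩ :=
    exists_path_eq_sub (R := R) (γ := γ) (γ' := ContinuousMap.const I (γ 0)) rfl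
  obtain ⟨δ, h0, h1, hδ⟩ := exists_path_eq_sub (R := R) (hr0.trans h)
  refine ⟨δ, h0.trans hr1, h1, fun c => ?_⟩
  rw [hδ, hr, apply_const, zero_sub, sub_neg_eq_add, add_comm]

/- The cocycles `c` and `h^* c` become cohomologous over `ℝ`, so their difference only depends on
the endpoints of a path. -/
theorem apply_comp_sub_eq_of_map_eq {c : singularCocycles ℤ E} {h : C(E, E)}
    (hh : map (R := ℝ) h (toReal (Submodule.Quotient.mk c)) = toReal (Submodule.Quotient.mk c))
    {γ γ' : C(I, E)} (h0 : γ 0 = γ' 0) (h1 : γ 1 = γ' 1) :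
    c.1 (h.comp γ) - c.1 (h.comp γ') = c.1 γ - c.1 γ' := by
  obtain ⟨b, hb⟩ := (Submodule.Quotient.eq _).1 hh
  have hbound : ∀ γ : C(I, E), b (γ 1) - b (γ 0) = (c.1 (h.comp γ) : ℝ) - c.1 γ :=
    fun γ => congrFun hb γ
  have hγ := hbound γ
  rw [h0, h1, hbound γ'] at hγ
  exact_mod_cast (by linear_combination -hγ :
    (c.1 (h.comp γ) : ℝ) - c.1 (h.comp γ') = c.1 γ - c.1 γ')

theorem map_symm_eq_of_map_eq {h : E ≃ₜ E} {v : SingularH1 R E}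
    (hv : map (R := R) (h : C(E, E)) v = v) :
    map (R := R) (h.symm : C(E, E)) v = v := by
  have hcomp : map (R := R) ((h : C(E, E)).comp (h.symm : C(E, E))) v = v := by
    rw [show (h : C(E, E)).comp (h.symm : C(E, E)) = ContinuousMap.id E from
      ContinuousMap.ext h.apply_symm_apply, map_id, LinearMap.id_apply]
  rwa [map_comp, LinearMap.comp_apply, hv] at hcomp

end SingularH1

theorem exists_homeomorph_comp_eq {E E' S S' : Type*} [TopologicalSpace E] [TopologicalSpace E']
    [TopologicalSpace S] [TopologicalSpace S'] {p : C(E, S)} {p' : C(E', S')}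
    (hp : IsQuotientMap p) (hp' : IsQuotientMap p') {F : E ≃ₜ E'}
    (hF : ∀ x y, p x = p y ↔ p' (F x) = p' (F y)) : ∃ h : S ≃ₜ S', ∀ x, p' (F x) = h (p x) := by
  refine ⟨(hp.homeomorph.symm.trans (Homeomorph.Quotient.congr F hF)).trans hp'.homeomorph,
    fun x => ?_⟩
  have hsymm : hp.homeomorph.symm (p x) = Quotient.mk (Setoid.ker p) x :=
    hp.homeomorph.symm_apply_apply (Quotient.mk (Setoid.ker p) x)
  rw [Homeomorph.trans_apply, Homeomorph.trans_apply, hsymm]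
  rfl

namespace IsCoverDefinedBy

variable {S E : Type*} [TopologicalSpace S] [TopologicalSpace E] {κ : Type*}
  {f : κ → SingularH1 ℤ S} {p : C(E, S)}

theorem eq_iff_of_start_eq (hp : IsCoverDefinedBy f p) {c : κ → singularCocycles ℤ S}
    (hc : ∀ i, Submodule.Quotient.mk (c i) = f i) {γ γ' : C(I, E)} (h0 : γ 0 = γ' 0)
    (h1 : p (γ 1) = p (γ' 1)) :
    γ 1 = γ' 1 ↔ ∀ i, (c i).1 (p.comp γ) = (c i).1 (p.comp γ') := by
  obtain ⟨δ, hδ0, hδ1, hδ⟩ := SingularH1.exists_path_eq_sub (R := ℤ) h0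
  have hloop : p (δ 0) = p (δ 1) := by rw [hδ0, hδ1, h1]
  rw [← hδ0, ← hδ1, hp.closed_iff δ hloop]
  refine forall_congr' fun i => ?_
  have hperiod : SingularH1.period ℤ (p.comp δ) hloop (f i) = (c i).1 (p.comp δ) := by
    rw [← hc i]
    rfl
  rw [hperiod, ← sub_eq_zero (b := (c i).1 (p.comp γ')), ← neg_sub, neg_eq_zero]
  exact Eq.congr (hδ (SingularH1.cocycleMap p (c i))) rfl

theorem exists_lift [PathConnectedSpace E] [LocallyPathConnectedSpace E]
    (hp : IsCoverDefinedBy f p) {h : C(S, S)}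
    (hh : ∀ i, SingularH1.map (R := ℝ) h (SingularH1.toReal (f i)) = SingularH1.toReal (f i))
    {x y : E} (hxy : p y = h (p x)) : ∃ F : C(E, E), F x = y ∧ ∀ z, p (F z) = h (p z) := by
  choose c hc using fun i => Submodule.Quotient.mk_surjective _ (f i)
  suffices ∃! F : C(E, E), F x = y ∧ p ∘ F = h.comp p by
    obtain ⟨F, ⟨hF, hpF⟩, -⟩ := this
    exact ⟨F, hF, congrFun hpF⟩
  refine hp.isCoveringMap.isLocalHomeomorph.existsUnique_continuousMap_lifts (h.comp p) x y hxy
    (fun γ hγ => ?_) fun γ γ' Γ Γ' h0 h0' H0 H0' hΓ hΓ' h1 => ?_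
  · obtain ⟨Γ, hΓ, hΓ0⟩ := hp.isCoveringMap.exists_path_lifts ((h.comp p).comp γ) y
      ((congrArg (h.comp p) hγ).trans hxy.symm)
    exact ⟨Γ, hΓ0, hΓ⟩
  · have hpΓ : p.comp Γ = h.comp (p.comp γ) := ContinuousMap.ext (congrFun hΓ)
    have hpΓ' : p.comp Γ' = h.comp (p.comp γ') := ContinuousMap.ext (congrFun hΓ')
    have hstart : γ 0 = γ' 0 := h0.trans h0'.symm
    have hend : p (Γ 1) = p (Γ' 1) :=
      (congrFun hΓ 1).trans ((congrArg (h.comp p) h1).trans (congrFun hΓ' 1).symm)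
    refine (hp.eq_iff_of_start_eq hc (H0.trans H0'.symm) hend).2 fun i => ?_
    have hbase := (hp.eq_iff_of_start_eq hc hstart (congrArg p h1)).1 h1 i
    rw [hpΓ, hpΓ', ← sub_eq_zero, SingularH1.apply_comp_sub_eq_of_map_eq
      (by rw [hc i]; exact hh i) (congrArg p hstart) (congrArg p h1), hbase, sub_self]

theorem exists_homeomorph_lift [PathConnectedSpace E] [LocallyPathConnectedSpace E]
    (hp : IsCoverDefinedBy f p) {h : S ≃ₜ S}
    (hh : ∀ i, SingularH1.map (R := ℝ) (h : C(S, S)) (SingularH1.toReal (f i)) =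
      SingularH1.toReal (f i))
    {x y : E} (hxy : p y = h (p x)) : ∃ F : E ≃ₜ E, F x = y ∧ ∀ z, p (F z) = h (p z) := by
  have hyx : p x = h.symm (p y) := by rw [hxy, h.symm_apply_apply]
  obtain ⟨F, hF, hpF⟩ := hp.exists_lift hh hxy
  obtain ⟨F', hF', hpF'⟩ := hp.exists_lift (fun i => SingularH1.map_symm_eq_of_map_eq (hh i)) hyx
  have hleft : F' ∘ F = id := hp.isCoveringMap.eq_of_comp_eq (by fun_prop) continuous_id
    (funext fun z => (hpF' (F z)).trans ((congrArg h.symm (hpF z)).trans (h.symm_apply_apply _)))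
    x ((congrArg F' hF).trans hF')
  have hright : F ∘ F' = id := hp.isCoveringMap.eq_of_comp_eq (by fun_prop) continuous_id
    (funext fun z => (hpF (F' z)).trans ((congrArg h (hpF' z)).trans (h.apply_symm_apply _)))
    y ((congrArg F hF').trans hF)
  exact ⟨⟨⟨F, F', congrFun hleft, congrFun hright⟩, F.continuous, F'.continuous⟩, hF, hpF⟩

theorem t2Space [T2Space S] (hp : IsCoverDefinedBy f p) : T2Space E := by
  refine ⟨fun x y hxy => ?_⟩
  by_cases h : p x = p y
  · exact hp.isCoveringMap.isSeparatedMap x y h hxy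
  · exact separated_by_continuous p.continuous h

theorem surjective [PathConnectedSpace S] (hp : IsCoverDefinedBy f p) :
    Function.Surjective p := by
  intro s
  obtain ⟨e⟩ := hp.connected.toNonempty
  let γ := PathConnectedSpace.somePath (p e) s
  obtain ⟨Γ, hΓ, -⟩ := hp.isCoveringMap.exists_path_lifts γ.toContinuousMap e γ.source
  exact ⟨Γ 1, (congrFun hΓ 1).trans γ.target⟩

/- The components of `τ y` are the values of cocycles representing the `f i` on the projection of
a path from `x` to `y`. -/
theorem exists_displacement [PathConnectedSpace E] (hp : IsCoverDefinedBy f p) (x : E) :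
    ∃ τ : E → κ → ℤ, (∀ y z, p y = p z → (y = z ↔ τ y = τ z)) ∧
      ∀ a : C(E, E), (∀ z, p (a z) = p z) → ∀ y, τ (a y) = τ (a x) + τ y := by
  choose c hc using fun i => Submodule.Quotient.mk_surjective _ (f i)
  let γ : E → C(I, E) := fun y => (PathConnectedSpace.somePath x y).toContinuousMap
  have h0 : ∀ y, γ y 0 = x := fun y => (PathConnectedSpace.somePath x y).source
  have h1 : ∀ y, γ y 1 = y := fun y => (PathConnectedSpace.somePath x y).target
  refine ⟨fun y i => (c i).1 (p.comp (γ y)), fun y z hyz => ?_, fun a ha y => ?_⟩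
  · rw [← h1 y, ← h1 z] at hyz
    rw [funext_iff, ← hp.eq_iff_of_start_eq hc ((h0 y).trans (h0 z).symm) hyz, h1, h1]
  · have hjoin : γ (a x) 1 = (a.comp (γ y)) 0 := by rw [h1, ContinuousMap.comp_apply, h0]
    obtain ⟨δ, hδ0, hδ1, hδ⟩ := SingularH1.exists_path_eq_add (R := ℤ) hjoin
    have hend : γ (a y) 1 = δ 1 := by rw [hδ1, h1, ContinuousMap.comp_apply, h1]
    have hpa : p.comp (a.comp (γ y)) = p.comp (γ y) := ContinuousMap.ext fun t => ha (γ y t)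
    have hstart : γ (a y) 0 = δ 0 := by rw [hδ0, h0, h0]
    funext i
    calc (c i).1 (p.comp (γ (a y)))
        = (c i).1 (p.comp δ) := (hp.eq_iff_of_start_eq hc hstart (congrArg p hend)).1 hend i
      _ = (c i).1 (p.comp (γ (a x))) + (c i).1 (p.comp (a.comp (γ y))) :=
        hδ (SingularH1.cocycleMap p (c i))
      _ = (c i).1 (p.comp (γ (a x))) + (c i).1 (p.comp (γ y)) := by rw [hpa]

end IsCoverDefinedBy

/-! ### Affine groups of covers -/

namespace TranslationSurface

variable {S : Type*} [TopologicalSpace S]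

theorem exists_openPartialHomeomorph (X : TranslationSurface S) (x : S) :
    ∃ e : OpenPartialHomeomorph S ℂ, x ∈ e.source := by
  by_cases hx : x ∈ X.sing
  · obtain ⟨w, k, hw⟩ := exists_isConeChart hx
    exact ⟨w, hw.mem_source⟩
  · obtain ⟨φ, -, hxφ⟩ := X.exists_chart x hx
    exact ⟨φ, hxφ⟩

theorem locallyPathConnectedSpace (X : TranslationSurface S) : LocallyPathConnectedSpace S := by
  choose e he using X.exists_openPartialHomeomorph
  let _ : ChartedSpace ℂ S := ⟨range e, e, he, mem_range_self⟩
  exact ChartedSpace.locallyPathConnectedSpace ℂ S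

theorem pathConnectedSpace [ConnectedSpace S] (X : TranslationSurface S) :
    PathConnectedSpace S := by
  have := X.locallyPathConnectedSpace
  exact pathConnectedSpace_iff_connectedSpace.2 inferInstance

section Pullback

variable {E : Type*} [TopologicalSpace E] {X : TranslationSurface S} {p : C(E, S)}
  {hloc : IsLocalHomeomorph p}

theorem IsAffine.of_lift {h : S ≃ₜ S} {A : SL(2, ℝ)} (hh : X.IsAffine h A) {F : E ≃ₜ E}
    (hF : ∀ z, p (F z) = h (p z)) : (X.pullback p hloc).IsAffine F A := by
  refine ⟨fun x => ?_, fun e he e' he' x hx hx' => ?_⟩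
  · change p (F x) ∈ X.sing ↔ p x ∈ X.sing
    rw [hF]
    exact hh.1 (p x)
  · have hxs : p x ∉ X.sing := disjoint_left.1 he.1 hx
    obtain ⟨φ, hφ, hxφ⟩ := X.exists_chart (p x) hxs
    obtain ⟨ψ, hψ, hxψ⟩ := X.exists_chart (h (p x)) (mt (hh.1 (p x)).1 hxs)
    obtain ⟨c, hc⟩ := he.2 φ hφ x hx hxφ
    obtain ⟨c', hc'⟩ := he'.2 ψ hψ (F x) hx' (by rwa [hF])
    obtain ⟨d, hd⟩ := hh.2 φ hφ ψ hψ (p x) hxφ hxψ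
    refine ⟨planeAct A c + d - c', ?_⟩
    filter_upwards [hc, F.continuous.continuousAt.eventually hc',
      p.continuous.continuousAt.eventually hd] with y hcy hcy' hdy
    rw [hF, hdy, hcy, planeAct_add] at hcy'
    linear_combination -hcy'

theorem IsAffine.of_descends (hsurj : Function.Surjective p) {F : E ≃ₜ E} {A : SL(2, ℝ)}
    (hF : (X.pullback p hloc).IsAffine F A) {h : S ≃ₜ S} (hh : ∀ z, p (F z) = h (p z)) :
    X.IsAffine h A := by
  refine ⟨hsurj.forall.2 fun x => ?_, fun φ hφ ψ hψ => hsurj.forall.2 fun x hx hx' => ?_⟩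
  · rw [← hh]
    exact hF.1 x
  · have hxs : x ∉ (X.pullback p hloc).sing := disjoint_left.1 (X.disjoint_sing φ hφ) hx
    obtain ⟨e, he, hxe⟩ := (X.pullback p hloc).exists_chart x hxs
    obtain ⟨e', he', hxe'⟩ := (X.pullback p hloc).exists_chart (F x) (mt (hF.1 x).1 hxs)
    obtain ⟨c, hc⟩ := he.2 φ hφ x hxe hx
    obtain ⟨c', hc'⟩ := he'.2 ψ hψ (F x) hxe' (by rwa [hh])
    obtain ⟨d, hd⟩ := hF.2 e he e' he' x hxe hxe'
    refine ⟨d + c' - planeAct A c, ?_⟩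
    rw [← hloc.map_nhds_eq x, eventually_map]
    filter_upwards [hc, F.continuous.continuousAt.eventually hc', hd] with y hcy hcy' hdy
    rw [← hh, hcy', hdy, hcy, planeAct_add]
    ring

variable (X p hloc) in
/-- The group of deck transformations of `p`, as translations of the pulled-back structure on the
cover. -/
def deckGroup : Subgroup (X.pullback p hloc).affineGroup where
  carrier := {g | g ∈ (X.pullback p hloc).derivative.ker ∧ ∀ z : E, p (g • z) = p z}
  one_mem' := ⟨one_mem _, fun _ => rfl⟩
  mul_mem' ha hb := ⟨mul_mem ha.1 hb.1, fun z => (ha.2 _).trans (hb.2 z)⟩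
  inv_mem' {a} ha := ⟨inv_mem ha.1, fun z => by rw [← ha.2, smul_inv_smul]⟩

theorem deckGroup_le_ker : X.deckGroup p hloc ≤ (X.pullback p hloc).derivative.ker :=
  fun _ hg => hg.1

variable {κ : Type*} {f : κ → SingularH1 ℤ S}

theorem exists_mem_deckGroup_smul_eq (hp : IsCoverDefinedBy f p) {x y : E} (hxy : p x = p y) :
    ∃ g ∈ X.deckGroup p hloc, g • x = y := by
  have := hp.connected
  have := (X.pullback p hloc).pathConnectedSpace
  have := (X.pullback p hloc).locallyPathConnectedSpace
  obtain ⟨F, hF, hpF⟩ := hp.exists_homeomorph_lift (h := Homeomorph.refl S)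
    (fun i => LinearMap.congr_fun SingularH1.map_id _) hxy.symm
  exact ⟨⟨(F, 1), IsAffine.one.of_lift hpF⟩, ⟨rfl, hpF⟩, hF⟩

theorem eq_of_mem_deckGroup_of_smul_eq (hp : IsCoverDefinedBy f p)
    {g h : (X.pullback p hloc).affineGroup} (hg : g ∈ X.deckGroup p hloc)
    (hh : h ∈ X.deckGroup p hloc) {x : E} (hgh : g • x = h • x) : g = h := by
  have := hp.connected
  have hmap : ⇑g.1.1 = h.1.1 := hp.isCoveringMap.eq_of_comp_eq g.1.1.continuous h.1.1.continuous
    (funext fun z => (hg.2 z).trans (hh.2 z).symm) x hgh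
  exact Subtype.ext (Prod.ext (DFunLike.coe_injective hmap) (hg.1.trans hh.1.symm))

theorem groupFG_deckGroup [Finite κ] (hp : IsCoverDefinedBy f p) :
    Group.FG (X.deckGroup p hloc) := by
  have := hp.connected
  have := (X.pullback p hloc).pathConnectedSpace
  obtain ⟨x⟩ := hp.connected.toNonempty
  obtain ⟨τ, hτ, hadd⟩ := hp.exists_displacement x
  let Φ : X.deckGroup p hloc →* Multiplicative (κ → ℤ) :=
    MonoidHom.mk' (fun g => Multiplicative.ofAdd (τ (g • x))) fun g h =>
      congrArg Multiplicative.ofAdd (hadd g.1.1.1 g.2.2 (h • x))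
  have hΦ : Function.Injective Φ := fun g h hgh =>
    Subtype.ext (eq_of_mem_deckGroup_of_smul_eq hp g.2 h.2
      ((hτ _ _ ((g.2.2 x).trans (h.2.2 x).symm)).2 (Multiplicative.ofAdd.injective hgh)))
  exact groupFG_of_injective_multiplicative_int hΦ

/- The translations of the cover permute the singular points, whose images in the base are finite
in number, and the deck group is transitive on the fibres. -/
theorem deckGroup_relIndex_ker_ne_zero [T2Space S] (hp : IsCoverDefinedBy f p)
    (hfin : X.sing.Finite) {x : E} (hx : p x ∈ X.sing) :
    (X.deckGroup p hloc).relIndex (X.pullback p hloc).derivative.ker ≠ 0 := by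
  have := hp.connected
  have := hp.t2Space
  have := finite_stabilizer_ker (X := X.pullback p hloc) hx
  let T := (X.pullback p hloc).derivative.ker
  have hindex : ((X.deckGroup p hloc).subgroupOf T).FiniteIndex := by
    refine finiteIndex_of_finite_image_orbit (x := x) (π := p) (hfin.subset ?_) fun y z hyz => ?_
    · rintro _ ⟨_, ⟨g, rfl⟩, rfl⟩
      exact (smul_mem_sing_iff g.1 x).2 hx
    · obtain ⟨g, hg, hgy⟩ := exists_mem_deckGroup_smul_eq (X := X) (hloc := hloc) hp hyz
      exact ⟨⟨g, deckGroup_le_ker hg⟩, hg, hgy⟩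
  exact hindex.index_ne_zero

theorem map_smul_eq_map_smul_of_mem_normalizer (hp : IsCoverDefinedBy f p)
    {g : (X.pullback p hloc).affineGroup}
    (hg : g ∈ Subgroup.normalizer (X.deckGroup p hloc : Set (X.pullback p hloc).affineGroup))
    {x y : E} (hxy : p x = p y) : p (g • x) = p (g • y) := by
  obtain ⟨δ, hδ, rfl⟩ := exists_mem_deckGroup_smul_eq (X := X) (hloc := hloc) hp hxy
  have hconj : g * δ * g⁻¹ ∈ X.deckGroup p hloc := (Subgroup.mem_normalizer_iff.1 hg δ).1 hδ
  calc p (g • x) = p ((g * δ * g⁻¹) • g • x) := (hconj.2 _).symm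
    _ = p (g • δ • x) := by rw [mul_smul, mul_smul, inv_smul_smul]

theorem derivative_mem_veechGroup_of_mem_normalizer [ConnectedSpace S]
    (hp : IsCoverDefinedBy f p) {g : (X.pullback p hloc).affineGroup}
    (hg : g ∈ Subgroup.normalizer (X.deckGroup p hloc : Set (X.pullback p hloc).affineGroup)) :
    (X.pullback p hloc).derivative g ∈ X.veechGroup := by
  have := X.pathConnectedSpace
  have hq : IsQuotientMap p := hp.isCoveringMap.isQuotientMap hp.surjective
  have hfibres : ∀ x y, p x = p y ↔ p (g.1.1 x) = p (g.1.1 y) := fun x y =>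
    ⟨map_smul_eq_map_smul_of_mem_normalizer hp hg, fun h => by
      simpa only [inv_smul_smul] using
        map_smul_eq_map_smul_of_mem_normalizer hp (inv_mem hg) (x := g • x) (y := g • y) h⟩
  obtain ⟨h, hh⟩ := exists_homeomorph_comp_eq hq hq hfibres
  exact ⟨⟨(h, g.1.2), g.2.of_descends hp.surjective hh⟩, rfl⟩

end Pullback

variable {X : TranslationSurface S}

theorem map_derivative_relIndex_veechGroup_ne_zero (H : Subgroup X.affineGroup)
    [H.FiniteIndex] : (H.map X.derivative).relIndex X.veechGroup ≠ 0 := by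
  have : (H ⊔ X.derivative.ker).FiniteIndex := Subgroup.finiteIndex_of_le le_sup_left
  rw [veechGroup, MonoidHom.range_eq_map, Subgroup.relIndex_map_map, top_sup_eq,
    Subgroup.relIndex_top_right]
  exact this.index_ne_zero

theorem exists_relIndex_ne_zero_le_veechGroup [T2Space S] [ConnectedSpace S] {E : Type*}
    [TopologicalSpace E] {p : C(E, S)} {hloc : IsLocalHomeomorph p} {κ : Type*} [Finite κ]
    {f : κ → SingularH1 ℤ S} (hp : IsCoverDefinedBy f p) (hfin : X.sing.Finite)
    (hsing : X.sing.Nonempty) :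
    ∃ V ≤ (X.pullback p hloc).veechGroup,
      V.relIndex (X.pullback p hloc).veechGroup ≠ 0 ∧ V ≤ X.veechGroup := by
  have := X.pathConnectedSpace
  obtain ⟨s, hs⟩ := hsing
  obtain ⟨x, rfl⟩ := hp.surjective s
  have := groupFG_deckGroup (X := X) (hloc := hloc) hp
  have := finiteIndex_normalizer (deckGroup_le_ker (X := X) (p := p) (hloc := hloc))
    (deckGroup_relIndex_ker_ne_zero hp hfin hs)
  refine ⟨_, Subgroup.map_le_range _ _, map_derivative_relIndex_veechGroup_ne_zero
    (Subgroup.normalizer (X.deckGroup p hloc : Set (X.pullback p hloc).affineGroup)), ?_⟩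
  rintro _ ⟨g, hg, rfl⟩
  exact derivative_mem_veechGroup_of_mem_normalizer hp hg

section Representation

variable {G : Subgroup X.affineGroup}

theorem range_linearPart : (linearPart G).range = G.map X.derivative := by
  rw [linearPart, MonoidHom.range_comp, Subgroup.range_subtype]

theorem range_linearPart_le_veechGroup : (linearPart G).range ≤ X.veechGroup :=
  range_linearPart.trans_le (Subgroup.map_le_range _ _)

theorem range_linearPart_relIndex_veechGroup_ne_zero [G.FiniteIndex] :
    (linearPart G).range.relIndex X.veechGroup ≠ 0 :=
  range_linearPart (G := G) ▸ map_derivative_relIndex_veechGroup_ne_zero G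

theorem mem_repKer_iff {F : Subrepresentation (rep G)} {g : G} :
    g ∈ repKer F ↔ ∀ v ∈ F.toSubmodule, rep G g v = v := by
  rw [repKer, MonoidHom.mem_ker]
  refine ⟨fun h v hv => congrArg Subtype.val (LinearMap.congr_fun h ⟨v, hv⟩), fun h => ?_⟩
  ext v
  exact h v.1 v.2

theorem repKer_sumSubrep {ι : Type*} (F : ι → Subrepresentation (rep G)) :
    repKer (sumSubrep F) = ⨅ j, repKer (F j) := by
  ext g
  have hfix : g ∈ repKer (sumSubrep F) ↔
      ⨆ j, (F j).toSubmodule ≤ LinearMap.eqLocus (rep G g) LinearMap.id := mem_repKer_iff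
  rw [hfix, iSup_le_iff, Subgroup.mem_iInf]
  exact forall_congr' fun j => mem_repKer_iff.symm

instance repKer_normal (F : Subrepresentation (rep G)) : (repKer F).Normal :=
  MonoidHom.normal_ker _

theorem map_repKer_le_veechGroup_pullback [ConnectedSpace S] {E : Type*} [TopologicalSpace E]
    {p : C(E, S)} {hloc : IsLocalHomeomorph p} {κ : Type*} {f : κ → SingularH1 ℤ S}
    (hp : IsCoverDefinedBy f p) {F : Subrepresentation (rep G)}
    (hfF : ∀ i, SingularH1.toReal (f i) ∈ F.toSubmodule) :
    (repKer F).map (linearPart G) ≤ (X.pullback p hloc).veechGroup := by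
  have := hp.connected
  have := X.pathConnectedSpace
  have := (X.pullback p hloc).pathConnectedSpace
  have := (X.pullback p hloc).locallyPathConnectedSpace
  rintro _ ⟨g, hg, rfl⟩
  have hfix : ∀ i, rep G g⁻¹ (SingularH1.toReal (f i)) = SingularH1.toReal (f i) :=
    fun i => mem_repKer_iff.1 (inv_mem hg) _ (hfF i)
  obtain ⟨x⟩ := hp.connected.toNonempty
  obtain ⟨y, hy⟩ := hp.surjective (g.1.1.1 (p x))
  obtain ⟨H, -, hH⟩ := hp.exists_homeomorph_lift (h := g.1.1.1) hfix hy
  exact ⟨⟨(H, g.1.1.2), g.1.2.of_lift hH⟩, rfl⟩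

end Representation

end TranslationSurface

namespace Fuchsian

theorem discreteTopology_of_le {Γ Δ : Subgroup SL(2, ℝ)} (h : Γ ≤ Δ) (hΔ : DiscreteTopology Δ) :
    DiscreteTopology Γ :=
  DiscreteTopology.of_subset (s := (Δ : Set SL(2, ℝ))) hΔ h

theorem discreteTopology_of_relIndex_ne_zero {Γ Δ : Subgroup SL(2, ℝ)} (h : Γ ≤ Δ)
    (hfin : Γ.relIndex Δ ≠ 0) (hΓ : DiscreteTopology Γ) : DiscreteTopology Δ := by
  have : Γ.IsFiniteRelIndex Δ := ⟨hfin⟩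
  exact (Subgroup.discreteTopology_iff_of_isFiniteRelIndex h).1 hΓ

end Fuchsian

theorem IsFirstKind.congr {Γ Δ : Subgroup SL(2, ℝ)} (hΓ : IsFirstKind Γ)
    (hΔ : DiscreteTopology Δ) (h : limitSet Δ = limitSet Γ) : IsFirstKind Δ :=
  ⟨hΔ, h.trans hΓ.2⟩

theorem IsSecondKind.congr {Γ Δ : Subgroup SL(2, ℝ)} (hΓ : IsSecondKind Γ)
    (hΔ : DiscreteTopology Δ) (h : limitSet Δ = limitSet Γ) : IsSecondKind Δ :=
  ⟨hΔ, h ▸ hΓ.2.1, h ▸ hΓ.2.2⟩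

namespace TranslationSurface

variable {S : Type*} [TopologicalSpace S] [T2Space S] [ConnectedSpace S] {X : TranslationSurface S}
  {G : Subgroup X.affineGroup} {ι : Type*} [Finite ι] {F : ι → Subrepresentation (rep G)}

theorem limitSet_map_repKer_sumSubrep (hfin : X.sing.Finite) (hsing : X.sing.Nonempty)
    (hG : ∀ g : G, IsOfFinOrder g → g = 1) (hK : ∀ j, repKer (F j) ≠ ⊥)
    (hdisc : DiscreteTopology (linearPart G).range)
    (hinf : (limitSet (linearPart G).range).Infinite) :
    limitSet ((repKer (sumSubrep F)).map (linearPart G)) = limitSet (linearPart G).range := by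
  have hinj := linearPart_injective hfin hsing hG
  have hne : repKer (sumSubrep F) ≠ ⊥ := by
    rw [repKer_sumSubrep]
    exact Fuchsian.iInf_ne_bot_of_normal hinj hdisc hinf hG (fun j => repKer_normal (F j)) hK
  exact Fuchsian.limitSet_map_eq_of_normal hinj hdisc hinf hG hne

variable {κ : Type*} [Finite κ] {f : κ → SingularH1 ℤ S} {E : Type*} [TopologicalSpace E]
  {p : C(E, S)} {hloc : IsLocalHomeomorph p}

theorem limitSet_veechGroup_pullback_subset (hp : IsCoverDefinedBy f p) (hfin : X.sing.Finite)
    (hsing : X.sing.Nonempty) :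
    limitSet (X.pullback p hloc).veechGroup ⊆ limitSet X.veechGroup := by
  obtain ⟨V, hVE, hVfin, hVX⟩ :=
    exists_relIndex_ne_zero_le_veechGroup (hloc := hloc) hp hfin hsing
  rw [← Fuchsian.limitSet_eq_of_relIndex_ne_zero hVE hVfin]
  exact Fuchsian.limitSet_mono hVX

theorem discreteTopology_veechGroup_pullback [G.FiniteIndex] (hp : IsCoverDefinedBy f p)
    (hfin : X.sing.Finite) (hsing : X.sing.Nonempty)
    (hdisc : DiscreteTopology (linearPart G).range) :
    DiscreteTopology (X.pullback p hloc).veechGroup := by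
  have hX : DiscreteTopology X.veechGroup := Fuchsian.discreteTopology_of_relIndex_ne_zero
    range_linearPart_le_veechGroup range_linearPart_relIndex_veechGroup_ne_zero hdisc
  obtain ⟨V, hVE, hVfin, hVX⟩ :=
    exists_relIndex_ne_zero_le_veechGroup (hloc := hloc) hp hfin hsing
  exact Fuchsian.discreteTopology_of_relIndex_ne_zero hVE hVfin
    (Fuchsian.discreteTopology_of_le hVX hX)

theorem limitSet_veechGroup_pullback [G.FiniteIndex] (hp : IsCoverDefinedBy f p)
    (hfin : X.sing.Finite) (hsing : X.sing.Nonempty) (hG : ∀ g : G, IsOfFinOrder g → g = 1)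
    (hfF : ∀ i, SingularH1.toReal (f i) ∈ (sumSubrep F).toSubmodule)
    (hK : ∀ j, repKer (F j) ≠ ⊥) (hdisc : DiscreteTopology (linearPart G).range)
    (hinf : (limitSet (linearPart G).range).Infinite) :
    limitSet (X.pullback p hloc).veechGroup = limitSet (linearPart G).range := by
  apply Subset.antisymm
  · rw [Fuchsian.limitSet_eq_of_relIndex_ne_zero range_linearPart_le_veechGroup
      range_linearPart_relIndex_veechGroup_ne_zero]
    exact limitSet_veechGroup_pullback_subset hp hfin hsing
  · rw [← limitSet_map_repKer_sumSubrep hfin hsing hG hK hdisc hinf]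
    exact Fuchsian.limitSet_mono (map_repKer_le_veechGroup_pullback hp hfF)

end TranslationSurface

end

theorem theorem1_general {S : Type*} [TopologicalSpace S] [T2Space S] [ConnectedSpace S]
    (X : TranslationSurface S) (hfin : X.sing.Finite) (hsing : X.sing.Nonempty)
    (G : Subgroup X.affineGroup) [G.FiniteIndex] (hG : ∀ g : G, IsOfFinOrder g → g = 1)
    {ι : Type*} [Finite ι] (F : ι → Subrepresentation (TranslationSurface.rep G))
    {κ : Type*} [Finite κ] (f : κ → SingularH1 ℤ S)
    (hfF : ∀ i, SingularH1.toReal (f i) ∈ (TranslationSurface.sumSubrep F).toSubmodule)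
    {E : Type*} [TopologicalSpace E] (p : C(E, S)) (hp : IsCoverDefinedBy f p)
    (hK : ∀ j, TranslationSurface.repKer (F j) ≠ ⊥) :
    TranslationSurface.repKer (TranslationSurface.sumSubrep F)
        = ⨅ j, TranslationSurface.repKer (F j) ∧
    (IsFirstKind (TranslationSurface.linearPart G).range →
      IsFirstKind ((TranslationSurface.repKer (TranslationSurface.sumSubrep F)).map
        (TranslationSurface.linearPart G)) ∧
      IsFirstKind (X.pullback p hp.isCoveringMap.isLocalHomeomorph).veechGroup) ∧
    (IsSecondKind (TranslationSurface.linearPart G).range →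
      IsSecondKind ((TranslationSurface.repKer (TranslationSurface.sumSubrep F)).map
        (TranslationSurface.linearPart G)) ∧
      IsSecondKind (X.pullback p hp.isCoveringMap.isLocalHomeomorph).veechGroup) := by
  have hKdisc := Fuchsian.discreteTopology_of_le (Subgroup.map_le_range
    (TranslationSurface.linearPart G) (TranslationSurface.repKer (TranslationSurface.sumSubrep F)))
  have hKlim := TranslationSurface.limitSet_map_repKer_sumSubrep hfin hsing hG hK
  have hEdisc := TranslationSurface.discreteTopology_veechGroup_pullback (G := G)
    (hloc := hp.isCoveringMap.isLocalHomeomorph) hp hfin hsing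
  have hElim := TranslationSurface.limitSet_veechGroup_pullback
    (hloc := hp.isCoveringMap.isLocalHomeomorph) hp hfin hsing hG hfF hK
  refine ⟨TranslationSurface.repKer_sumSubrep F, fun h => ?_, fun h => ?_⟩
  · have hinf : (limitSet (TranslationSurface.linearPart G).range).Infinite :=
      h.2 ▸ Set.infinite_univ
    exact ⟨h.congr (hKdisc h.1) (hKlim h.1 hinf), h.congr (hEdisc h.1) (hElim h.1 hinf)⟩
  · exact ⟨h.congr (hKdisc h.1) (hKlim h.1 h.2.1), h.congr (hEdisc h.1) (hElim h.1 h.2.1)⟩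

theorem theorem1
    -- a compact connected translation surface `X`, with underlying space `S`
    {S : Type*} [TopologicalSpace S] [CompactSpace S] [T2Space S] [ConnectedSpace S]
    (X : TranslationSurface S) (hsing : X.sing.Nonempty)
    -- a torsion-free group of affine automorphisms, of finite index
    (G : Subgroup X.affineGroup) [G.FiniteIndex] (hG : ∀ g : G, IsOfFinOrder g → g = 1)
    -- integer invariant subspaces in direct sum
    {n : ℕ} (F : Fin n → Subrepresentation (TranslationSurface.rep G))
    (hFint : ∀ j, SingularH1.IsInteger (F j).toSubmodule)
    (hFsum : iSupIndep fun j => (F j).toSubmodule)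
    -- the cover defined by a tuple of integer classes in their sum
    {d : ℕ} (f : Fin d → SingularH1 ℤ S) (hf : LinearIndependent ℤ f)
    (hfF : ∀ i, SingularH1.toReal (f i) ∈ (TranslationSurface.sumSubrep F).toSubmodule)
    {E : Type*} [TopologicalSpace E] (p : C(E, S)) (hp : IsCoverDefinedBy f p)
    -- all the kernels are non-trivial
    (hK : ∀ j, TranslationSurface.repKer (F j) ≠ ⊥) :
    TranslationSurface.repKer (TranslationSurface.sumSubrep F)
        = ⨅ j, TranslationSurface.repKer (F j) ∧
    (IsFirstKind (TranslationSurface.linearPart G).range →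
      IsFirstKind ((TranslationSurface.repKer (TranslationSurface.sumSubrep F)).map
        (TranslationSurface.linearPart G)) ∧
      IsFirstKind (X.pullback p hp.isCoveringMap.isLocalHomeomorph).veechGroup) ∧
    (IsSecondKind (TranslationSurface.linearPart G).range →
      IsSecondKind ((TranslationSurface.repKer (TranslationSurface.sumSubrep F)).map
        (TranslationSurface.linearPart G)) ∧
      IsSecondKind (X.pullback p hp.isCoveringMap.isLocalHomeomorph).veechGroup) :=
  theorem1_general X X.finite_sing hsing G hG F f hfF p hp hK
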